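/- Let $d\ge 2$ and $\mathbb{R}^d_+=\{x\in\mathbb{R}^d: x_i>0 \text{ for all } i\}$; write $x\leqq y$ if $x_i\le y_i$ for all $i$. Let $\Omega\subset\mathbb{R}^d_+$ be open and bounded and let $f:\mathbb{R}^d\to[0,\infty)$. Assume: (H1) there is a continuous nondecreasing $m:[0,\infty)\to[0,\infty)$ with $m(0)=0$ such that $|f(x)-f(y)|\le m(|x-y|)$ for all $x,y\in\Omega$, and $f(x)=0$ for $x\notin\Omega$; (H2*) for every $x\in\partial\Omega$ there are a cone $\mathcal K_x$ (with vertex at the origin) with nonempty interior and a neighborhood $V_x$ of $x$ such that $(y+\mathcal K_x)\cap\overline\Omega\cap V_x\subset\{y\}$ for every $y\in V_x\setminus\Omega$; and the normalization $\operatorname{supp}(f)\subset[0,1]^d$. A viscosity solution of $u_{x_1}\cdots u_{x_d}=f$ on $\mathbb{R}^d_+$ is a continuous function $u$ such that for every $x\in\mathbb{R}^d_+$ one has $p_1\cdots p_d\le f^*(x)$ for all $p\in D^+u(x)$ and $p_1\cdots p_d\ge f_*(x)$ for all $p\in D^-u(x)$. Here $f^*,f_*$ are the upper and lower semicontinuous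 envelopes of $f$, and $D^{+}u(x)$ (resp. $D^-u(x)$) is the set of $p\in\mathbb{R}^d$ with $u(y)\le u(x)+\langle p,y-x\rangle+o(|y-x|)$ (resp. $\ge$) as $y\to x$. The function $u$ is Pareto-monotone if $x\leqq y$ implies $u(x)\le u(y)$. Then there is exactly one continuous function $u:\overline{\mathbb{R}^d_+}\to\mathbb{R}$ that is a Pareto-monotone viscosity solution of $$u_{x_1}\cdots u_{x_d}=f\ \text{ on }\mathbb{R}^d_+,\qquad u=0\ \text{ on }\partial\mathbb{R}^d_+,$$ and satisfies $$u(x)=u(\min(x_1,1),\dots,\min(x_d,1))\qquad\text{for } x\in\mathbb{R}^d_+ .$$ Moreover, $u=d\cdot U$ on $\overline{\mathbb{R}^d_+}$, where $$U(x)=\sup\left\{\int_0^1 f(\gamma(t))^{1/d}\,(\gamma_1'(t)\cdots\gamma_d'(t))^{1/d}\,dt\right\},$$ the supremum being over all $\gamma\in C^1([0,1];\mathbb{R}^d)$ with $\gamma(1)\leqq x$ and, for all $t\in[0,1]$, $\gamma_i'(t)\ge0$ for every $i$ and $\gamma'(t)\ne0$. -/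

import Mathlib

open Set Filter Topology
open scoped NNReal

noncomputable section

namespace ParetoHJ

/-- Euclidean space of dimension `d`. -/
abbrev E (d : ℕ) : Type := EuclideanSpace ℝ (Fin d)

/-- The componentwise (weak) partial order on Euclidean space. -/
def CompLE {d : ℕ} (x y : E d) : Prop := ∀ i, x i ≤ y i

/-- The open positive orthant. -/
def orthant (d : ℕ) : Set (E d) := {x | ∀ i, 0 < x i}

/-- The closed unit cube. -/
def unitCube (d : ℕ) : Set (E d) := {x | ∀ i, 0 ≤ x i ∧ x i ≤ 1}

/-- The point `(min (x_1, 1), …, min (x_d, 1))`. -/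
def truncOne {d : ℕ} (x : E d) : E d := WithLp.toLp 2 (fun i => min (x i) 1)

/-- The function `u` is monotone on `O` for the componentwise order. -/
def ParetoMonotoneOn {d : ℕ} (O : Set (E d)) (u : E d → ℝ) : Prop :=
  ∀ x ∈ O, ∀ y ∈ O, CompLE x y → u x ≤ u y

/-- `f` vanishes outside `Ω` and has a modulus of continuity `m` on `Ω`. -/
def HasModulusOn {d : ℕ} (Ω : Set (E d)) (f : E d → ℝ) : Prop :=
  (∃ m : ℝ≥0 → ℝ≥0, Continuous m ∧ Monotone m ∧ m 0 = 0 ∧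
    ∀ x ∈ Ω, ∀ y ∈ Ω, |f x - f y| ≤ m (nndist x y)) ∧
  ∀ x, x ∉ Ω → f x = 0

/-- A cone with vertex at the origin. -/
def IsCone {d : ℕ} (K : Set (E d)) : Prop := ∀ t : ℝ, 0 < t → ∀ k ∈ K, t • k ∈ K

/-- The exterior cone condition: each boundary point `x` has a cone `K` with nonempty interior
and a neighborhood `V` such that `(y + K) ∩ closure Ω ∩ V ⊆ {y}` for every `y ∈ V \ Ω`. -/
def ConeCondition {d : ℕ} (Ω : Set (E d)) : Prop :=
  ∀ x ∈ frontier Ω, ∃ K : Set (E d), IsCone K ∧ (interior K).Nonempty ∧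
    ∃ V ∈ 𝓝 x, ∀ y ∈ V \ Ω, ((fun k => y + k) '' K) ∩ closure Ω ∩ V ⊆ {y}

/-- Upper semicontinuous envelope of `f` relative to `O` (for bounded `f`). -/
def uscEnv {d : ℕ} (O : Set (E d)) (f : E d → ℝ) (x : E d) : ℝ := limsup f (𝓝[O] x)

/-- Lower semicontinuous envelope of `f` relative to `O` (for bounded `f`). -/
def lscEnv {d : ℕ} (O : Set (E d)) (f : E d → ℝ) (x : E d) : ℝ :=
  -uscEnv O (fun y => -f y) x

/-- The superdifferential of `u` at `x` relative to `O`: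
`u y ≤ u x + ⟨p, y - x⟩ + o(|y - x|)` as `y → x` in `O`. -/
def superDiff {d : ℕ} (O : Set (E d)) (u : E d → ℝ) (x : E d) : Set (E d) :=
  {p | ∀ ε : ℝ, 0 < ε → ∀ᶠ y in 𝓝[O] x, u y ≤ u x + inner ℝ p (y - x) + ε * ‖y - x‖}

/-- The subdifferential of `u` at `x` relative to `O`:
`u y ≥ u x + ⟨p, y - x⟩ + o(|y - x|)` as `y → x` in `O`. -/
def subDiff {d : ℕ} (O : Set (E d)) (u : E d → ℝ) (x : E d) : Set (E d) :=
  {p | ∀ ε : ℝ, 0 < ε → ∀ᶠ y in 𝓝[O] x, u x + inner ℝ p (y - x) - ε * ‖y - x‖ ≤ u y}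

/-- Viscosity subsolutions of `H(Du) = f` on `O`. -/
def IsViscSub {d : ℕ} (O : Set (E d)) (H : E d → ℝ) (f u : E d → ℝ) : Prop :=
  ContinuousOn u O ∧ ∀ x ∈ O, ∀ p ∈ superDiff O u x, H p ≤ uscEnv O f x

/-- Viscosity supersolutions of `H(Du) = f` on `O`. -/
def IsViscSuper {d : ℕ} (O : Set (E d)) (H : E d → ℝ) (f u : E d → ℝ) : Prop :=
  ContinuousOn u O ∧ ∀ x ∈ O, ∀ p ∈ subDiff O u x, lscEnv O f x ≤ H p

/-- Viscosity solutions of `H(Du) = f` on `O`. -/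
def IsViscSol {d : ℕ} (O : Set (E d)) (H : E d → ℝ) (f u : E d → ℝ) : Prop :=
  IsViscSub O H f u ∧ IsViscSuper O H f u

/-- The Hamiltonian `p ↦ p_1 ⋯ p_d`. -/
def prodH {d : ℕ} (p : E d) : ℝ := ∏ i, p i

/-- Pareto-monotone viscosity solutions of `u_{x_1} ⋯ u_{x_d} = f` in the positive orthant,
continuous up to the boundary with `u = 0` there, and satisfying
`u(x) = u(min(x_1, 1), …, min(x_d, 1))`. Only the values of `u` on the closed orthant matter. -/
structure IsParetoSolution {d : ℕ} (f u : E d → ℝ) : Prop where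
  continuousOn : ContinuousOn u (closure (orthant d))
  viscosity : IsViscSol (orthant d) prodH f u
  boundary : ∀ x ∈ frontier (orthant d), u x = 0
  monotone : ParetoMonotoneOn (orthant d) u
  truncation : ∀ x ∈ orthant d, u x = u (truncOne x)

/-- The velocity of a curve parametrized by `[0, 1]` (one-sided at the endpoints). -/
def velocity {d : ℕ} (γ : ℝ → E d) (t : ℝ) : E d := derivWithin γ (Icc 0 1) t

/-- Admissible curves: `C¹` on `[0, 1]`, with every velocity nonzero and componentwise
nonnegative. -/
def Admissible {d : ℕ} (γ : ℝ → E d) : Prop :=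
  ContDiffOn ℝ 1 γ (Icc 0 1) ∧
    ∀ t ∈ Icc (0 : ℝ) 1, (∀ i, 0 ≤ velocity γ t i) ∧ velocity γ t ≠ 0

/-- The energy `∫₀¹ f(γ)^{1/d} (γ_1' ⋯ γ_d')^{1/d} dt`. -/
def energy {d : ℕ} (f : E d → ℝ) (γ : ℝ → E d) : ℝ :=
  ∫ t in (0 : ℝ)..1, f (γ t) ^ (1 / (d : ℝ)) * (∏ i, velocity γ t i) ^ (1 / (d : ℝ))

/-- The value function: supremum of the energy over admissible curves with `γ(1) ≤ x`. -/
def valueFn {d : ℕ} (f : E d → ℝ) (x : E d) : ℝ :=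
  sSup {J | ∃ γ : ℝ → E d, Admissible γ ∧ CompLE (γ 1) x ∧ J = energy f γ}

end ParetoHJ

end

noncomputable section

open MeasureTheory

namespace ParetoHJ

/-! ### The orthant, semicontinuous envelopes, semidifferentials, and the cone condition. -/

section

variable {d : ℕ}

/-! The equation is the Hamilton–Jacobi equation of the control problem that defines `U`. The link
is AM-GM: for nonnegative `p`, `q` one has `d (∏ p_i)^{1/d} (∏ q_i)^{1/d} ≤ ∑ p_i q_i`
(`mul_rpow_prod_le_sum`), with equality when all `p_i q_i` agree.

Existence. Hölder with `d` exponents `1/d` bounds the energy a monotone curve collects in a box by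
`(sup f)^{1/d}` times the `d`-th root of the volume (`lintegral_lagrangian_box_le`). This yields
finiteness and continuity of `U`, and the upper half of dynamic programming, where a curve is cut on
entering a small cube below `x` (`exists_entrance`). The lower half appends a segment to a curve
(`valueFn_add_segment_le`). Such concatenations are not `C¹`, but integrable velocities give no
larger supremum (`lintegral_endCurve_le`): approximate in `L¹` and use Fatou, which works because
`f` is lower semicontinuous. The two halves, combined with AM-GM, make `d * U` a sub- and a
supersolution.

Uniqueness. Since `f` jumps across `∂Ω`, plain doubling of variables could leave `f^*(x)` far above
`f(y)`. The penalty `|α(x - y) - e|²`, with `e` interior to the exterior cone, makes `x - y` point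
into the cone, so `y ∉ Ω` forces `x ∉ closure Ω` and `f^*(x) = 0`; if `y ∈ Ω`, the modulus of `f`
applies. Adding `ε ∑ z_i` to the supersolution gives strictness: monotonicity makes its subgradients
nonnegative, so the product of gradient components rises by at least `(ε/2)^d`
(`not_isLocalMax_sub`). The truncation condition places a maximum of the difference in a compact
cube (`IsParetoSolution.le`). -/

theorem isOpen_orthant (d : ℕ) : IsOpen (orthant d) := by
  simp only [orthant, ofPred_forall]
  exact isOpen_iInter_of_finite fun i => isOpen_lt continuous_const (by fun_prop)

theorem nonneg_of_mem_closure_orthant {x : E d} (hx : x ∈ closure (orthant d)) (i : Fin d) :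
    0 ≤ x i := by
  have hc : IsClosed {y : E d | 0 ≤ y i} := isClosed_le continuous_const (by fun_prop)
  exact closure_minimal (fun y hy => (hy i).le) hc hx

theorem exists_nonpos_of_mem_frontier_orthant {x : E d} (hx : x ∈ frontier (orthant d)) :
    ∃ i, x i ≤ 0 := by
  rw [(isOpen_orthant d).frontier_eq] at hx
  by_contra! h
  exact hx.2 h

theorem mem_orthant_of_not_mem_frontier {x : E d} (hx : x ∈ closure (orthant d))
    (h : x ∉ frontier (orthant d)) : x ∈ orthant d := by
  rw [(isOpen_orthant d).frontier_eq] at h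
  by_contra h'
  exact h ⟨hx, h'⟩

theorem truncOne_mem_orthant {x : E d} (hx : x ∈ orthant d) : truncOne x ∈ orthant d :=
  fun i => lt_min (hx i) one_pos

theorem truncOne_mem_unitCube {x : E d} (hx : x ∈ orthant d) : truncOne x ∈ unitCube d :=
  fun i => ⟨(truncOne_mem_orthant hx i).le, min_le_right _ _⟩

theorem isCompact_unitCube (d : ℕ) : IsCompact (unitCube d) := by
  have h : unitCube d = (EuclideanSpace.equiv (Fin d) ℝ).toHomeomorph ⁻¹'
      (Set.pi univ fun _ => Icc (0 : ℝ) 1) := by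
    ext x
    simp [unitCube, Pi.le_def, forall_and]
  rw [h, Homeomorph.isCompact_preimage]
  exact isCompact_univ_pi fun _ => isCompact_Icc

/-- A nonnegative function bounded by `M`, continuous on the open set `Ω` and vanishing
outside. -/
structure IsWeight (Ω : Set (E d)) (f : E d → ℝ) (M : ℝ) : Prop where
  isOpen : IsOpen Ω
  nonneg : ∀ x, 0 ≤ f x
  le : ∀ x, f x ≤ M
  continuousOn : ContinuousOn f Ω
  eq_zero : ∀ x, x ∉ Ω → f x = 0

theorem HasModulusOn.exists_uniform {Ω : Set (E d)} {f : E d → ℝ} (h : HasModulusOn Ω f) {η : ℝ}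
    (hη : 0 < η) : ∃ ρ > 0, ∀ x ∈ Ω, ∀ y ∈ Ω, dist x y < ρ → |f x - f y| ≤ η := by
  obtain ⟨⟨m, hm, -, hm0, hmod⟩, -⟩ := h
  have h1 : ∀ᶠ t in 𝓝 (0 : ℝ≥0), (m t : ℝ) < η := by
    have : Tendsto (fun t => (m t : ℝ)) (𝓝 0) (𝓝 0) := by
      have h2 : Continuous fun t => (m t : ℝ) := NNReal.continuous_coe.comp hm
      simpa [hm0] using h2.tendsto 0
    exact this.eventually_lt_const hη
  obtain ⟨ρ, hρ, hball⟩ := Metric.eventually_nhds_iff.1 h1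
  refine ⟨ρ, hρ, fun x hx y hy hxy => (hmod x hx y hy).trans (hball ?_).le⟩
  rw [NNReal.dist_eq]
  simpa using hxy

theorem exists_isWeight {Ω : Set (E d)} {f : E d → ℝ} (hΩ : IsOpen Ω)
    (hb : Bornology.IsBounded Ω) (hf : ∀ x, 0 ≤ f x) (hm : HasModulusOn Ω f) :
    ∃ M, IsWeight Ω f M := by
  have hcont : ContinuousOn f Ω := by
    intro x hx
    rw [ContinuousWithinAt, Metric.tendsto_nhdsWithin_nhds]
    intro ε hε
    obtain ⟨ρ, hρ, h⟩ := hm.exists_uniform (half_pos hε)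
    refine ⟨ρ, hρ, fun y hy hyx => ?_⟩
    rw [Real.dist_eq]
    linarith [h y hy x hx hyx]
  have hbd : ∃ M, ∀ x, f x ≤ M := by
    rcases Ω.eq_empty_or_nonempty with rfl | ⟨y, hy⟩
    · exact ⟨0, fun x => (hm.2 x (by simp)).le⟩
    · obtain ⟨⟨m, -, hmono, -, hmod⟩, hz⟩ := hm
      refine ⟨f y + m (Real.toNNReal (Metric.diam Ω)), fun x => ?_⟩
      by_cases hx : x ∈ Ω
      · have h1 := (abs_le.1 (hmod x hx y hy)).2
        have h2 : nndist x y ≤ Real.toNNReal (Metric.diam Ω) := by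
          rw [← NNReal.coe_le_coe, Real.coe_toNNReal _ Metric.diam_nonneg]
          simpa using Metric.dist_le_diam_of_mem hb hx hy
        have h3 : (m (nndist x y) : ℝ) ≤ m (Real.toNNReal (Metric.diam Ω)) :=
          NNReal.coe_le_coe.2 (hmono h2)
        linarith
      · rw [hz x hx]
        have := hf y
        positivity
  obtain ⟨M, hM⟩ := hbd
  exact ⟨M, hΩ, hf, hM, hcont, hm.2⟩

namespace IsWeight

variable {Ω : Set (E d)} {f : E d → ℝ} {M : ℝ}

theorem continuousAt (hw : IsWeight Ω f M) {x : E d} (hx : x ∈ Ω) : ContinuousAt f x :=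
  hw.continuousOn.continuousAt (hw.isOpen.mem_nhds hx)

theorem mem_of_pos (hw : IsWeight Ω f M) {x : E d} (hx : 0 < f x) : x ∈ Ω := by
  by_contra h
  exact hx.ne' (hw.eq_zero x h)

theorem isBoundedUnder (hw : IsWeight Ω f M) (l : Filter (E d)) :
    l.IsBoundedUnder (· ≤ ·) f := isBoundedUnder_of ⟨M, hw.le⟩

theorem isBoundedUnder_ge (hw : IsWeight Ω f M) (l : Filter (E d)) :
    l.IsBoundedUnder (· ≥ ·) f := isBoundedUnder_of ⟨0, hw.nonneg⟩

theorem uscEnv_le (hw : IsWeight Ω f M) {O : Set (E d)} (hO : IsOpen O) {x : E d} (hx : x ∈ O)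
    {c : ℝ} (h : ∀ᶠ z in 𝓝 x, f z ≤ c) : uscEnv O f x ≤ c := by
  rw [uscEnv, hO.nhdsWithin_eq hx]
  exact limsup_le_of_le (hw.isBoundedUnder_ge _).isCoboundedUnder_le h

theorem eventually_lt (hw : IsWeight Ω f M) {O : Set (E d)} (hO : IsOpen O) {x : E d} (hx : x ∈ O)
    {c : ℝ} (h : uscEnv O f x < c) : ∀ᶠ z in 𝓝 x, f z < c := by
  rw [uscEnv, hO.nhdsWithin_eq hx] at h
  exact eventually_lt_of_limsup_lt h (hw.isBoundedUnder _)

theorem uscEnv_nonneg (hw : IsWeight Ω f M) {O : Set (E d)} (hO : IsOpen O) {x : E d}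
    (hx : x ∈ O) : 0 ≤ uscEnv O f x := by
  rw [uscEnv, hO.nhdsWithin_eq hx]
  exact le_limsup_of_frequently_le (Eventually.of_forall hw.nonneg).frequently
    (hw.isBoundedUnder _)

/-- `f` is lower semicontinuous: it is continuous on the open set `Ω`, and outside it attains its
minimum `0`. -/
theorem lscEnv_eq (hw : IsWeight Ω f M) {O : Set (E d)} (hO : IsOpen O) {x : E d} (hx : x ∈ O) :
    lscEnv O f x = f x := by
  rw [lscEnv, uscEnv, hO.nhdsWithin_eq hx]
  by_cases hxΩ : x ∈ Ω
  · have ht : Tendsto (fun y => -f y) (𝓝 x) (𝓝 (-f x)) := (hw.continuousAt hxΩ).neg.tendsto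
    rw [ht.limsup_eq, neg_neg]
  · have hb : (𝓝 x).IsBoundedUnder (· ≤ ·) fun y => -f y :=
      isBoundedUnder_of ⟨0, fun y => neg_nonpos.2 (hw.nonneg y)⟩
    have hb' : (𝓝 x).IsBoundedUnder (· ≥ ·) fun y => -f y :=
      isBoundedUnder_of ⟨-M, fun y => neg_le_neg (hw.le y)⟩
    rw [hw.eq_zero x hxΩ, neg_eq_zero]
    apply le_antisymm
    · exact limsup_le_of_le hb'.isCoboundedUnder_le
        (Eventually.of_forall fun y => neg_nonpos.2 (hw.nonneg y))
    · refine le_limsup_of_frequently_le ?_ hb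
      intro h
      exact h.self_of_nhds (by simp [hw.eq_zero x hxΩ])

end IsWeight

theorem mem_superDiff_of_quadratic {O : Set (E d)} (hO : IsOpen O) {u : E d → ℝ} {x p : E d}
    (hx : x ∈ O) (C : ℝ)
    (h : ∀ᶠ y in 𝓝 x, u y ≤ u x + inner ℝ p (y - x) + C * ‖y - x‖ ^ 2) :
    p ∈ superDiff O u x := by
  intro ε hε
  rw [hO.nhdsWithin_eq hx]
  have h1 : Tendsto (fun y : E d => C * ‖y - x‖) (𝓝 x) (𝓝 0) := by
    have : Continuous fun y : E d => C * ‖y - x‖ := by fun_prop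
    simpa using this.tendsto x
  filter_upwards [h, h1.eventually_lt_const hε] with y hy hy'
  nlinarith [norm_nonneg (y - x)]

theorem mem_subDiff_of_quadratic {O : Set (E d)} (hO : IsOpen O) {u : E d → ℝ} {x p : E d}
    (hx : x ∈ O) (C : ℝ)
    (h : ∀ᶠ y in 𝓝 x, u x + inner ℝ p (y - x) - C * ‖y - x‖ ^ 2 ≤ u y) :
    p ∈ subDiff O u x := by
  intro ε hε
  rw [hO.nhdsWithin_eq hx]
  have h1 : Tendsto (fun y : E d => C * ‖y - x‖) (𝓝 x) (𝓝 0) := by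
    have : Continuous fun y : E d => C * ‖y - x‖ := by fun_prop
    simpa using this.tendsto x
  filter_upwards [h, h1.eventually_lt_const hε] with y hy hy'
  nlinarith [norm_nonneg (y - x)]

theorem tendsto_add_smul_nhds (x q : E d) :
    Tendsto (fun h : ℝ => x + h • q) (𝓝[>] 0) (𝓝 x) := by
  have h1 : Continuous fun h : ℝ => x + h • q := by fun_prop
  have h2 := h1.tendsto 0
  simp only [zero_smul, add_zero] at h2
  exact h2.mono_left nhdsWithin_le_nhds

theorem tendsto_sub_smul_nhds (x q : E d) :
    Tendsto (fun h : ℝ => x - h • q) (𝓝[>] 0) (𝓝 x) := by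
  have := tendsto_add_smul_nhds x (-q)
  simpa [sub_eq_add_neg] using this

/-- A forward step `h` along a coordinate axis cannot decrease `u`, while the expansion bounds the
increment by `h * (p i + ε)`. The subdifferential version steps backward. -/
theorem nonneg_of_mem_superDiff {O : Set (E d)} (hO : IsOpen O) {u : E d → ℝ}
    (hu : ParetoMonotoneOn O u) {x p : E d} (hx : x ∈ O) (hp : p ∈ superDiff O u x) (i : Fin d) :
    0 ≤ p i := by
  refine le_of_forall_pos_le_add fun ε hε => ?_
  have h1 := hp ε hε
  rw [hO.nhdsWithin_eq hx] at h1
  have h2 := (tendsto_add_smul_nhds x (EuclideanSpace.single i 1)).eventually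
    (h1.and (hO.mem_nhds hx))
  obtain ⟨h, ⟨h3, h4⟩, h5⟩ := (h2.and self_mem_nhdsWithin).exists
  have h5 : 0 < h := h5
  have h6 := hu x hx _ h4 fun j => by
    by_cases hj : j = i <;> simp [hj, h5.le]
  simp only [add_sub_cancel_left, inner_smul_right, norm_smul, EuclideanSpace.inner_single_right,
    PiLp.norm_single, Real.norm_eq_abs, abs_of_pos h5] at h3
  simp only [one_mul, mul_one, abs_one] at h3
  have h7 : 0 ≤ h * (p i + ε) := by
    have : ((starRingEnd ℝ) (p i)) = p i := rfl
    rw [this] at h3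
    linarith
  exact nonneg_of_mul_nonneg_right h7 h5

theorem nonneg_of_mem_subDiff {O : Set (E d)} (hO : IsOpen O) {u : E d → ℝ}
    (hu : ParetoMonotoneOn O u) {x p : E d} (hx : x ∈ O) (hp : p ∈ subDiff O u x) (i : Fin d) :
    0 ≤ p i := by
  refine le_of_forall_pos_le_add fun ε hε => ?_
  have h1 := hp ε hε
  rw [hO.nhdsWithin_eq hx] at h1
  have h2 := (tendsto_sub_smul_nhds x (EuclideanSpace.single i 1)).eventually
    (h1.and (hO.mem_nhds hx))
  obtain ⟨h, ⟨h3, h4⟩, h5⟩ := (h2.and self_mem_nhdsWithin).exists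
  have h5 : 0 < h := h5
  have h6 := hu _ h4 x hx fun j => by
    by_cases hj : j = i <;> simp [hj, h5.le]
  simp only [sub_sub_cancel_left, inner_neg_right, norm_neg, inner_smul_right, norm_smul,
    EuclideanSpace.inner_single_right,
    PiLp.norm_single, Real.norm_eq_abs, abs_of_pos h5] at h3
  simp only [one_mul, mul_one, abs_one] at h3
  have h7 : 0 ≤ h * (p i + ε) := by
    have : ((starRingEnd ℝ) (p i)) = p i := rfl
    rw [this] at h3
    linarith
  exact nonneg_of_mul_nonneg_right h7 h5

/-- The exterior cone condition yields, near every point, a direction `e` such that displacements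
`x - y` close to a positive multiple of `e` cannot have `y ∉ Ω` and `x ∈ closure Ω`. -/
theorem ConeCondition.exists_direction (hd : 2 ≤ d) {Ω : Set (E d)} (hΩ : IsOpen Ω)
    (hc : ConeCondition Ω) (x₀ : E d) : ∃ e : E d, ∃ δ > 0, ∀ x y : E d, ∀ α : ℝ, 0 < α →
      dist x x₀ < δ → dist y x₀ < δ → ‖α • (x - y) - e‖ < δ → y ∈ Ω ∨ x ∉ closure Ω := by
  by_cases h1 : x₀ ∈ Ω
  · obtain ⟨δ, hδ, hb⟩ := Metric.isOpen_iff.1 hΩ x₀ h1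
    exact ⟨0, δ, hδ, fun x y α _ _ hy _ => Or.inl (hb hy)⟩
  by_cases h2 : x₀ ∈ closure Ω
  · have hfr : x₀ ∈ frontier Ω := by rw [hΩ.frontier_eq]; exact ⟨h2, h1⟩
    obtain ⟨K, hK, hKi, V, hV, hKV⟩ := hc x₀ hfr
    have : Nonempty (Fin d) := ⟨⟨0, by omega⟩⟩
    have : Nontrivial (E d) := inferInstance
    -- A nonempty open set in positive dimension is not `{0}`.
    obtain ⟨e, he, he0⟩ : ∃ e ∈ interior K, e ≠ 0 := by
      obtain ⟨e, he⟩ := hKi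
      by_contra! hall
      have hsub : interior K = {0} := by
        have h0 := hall e he
        subst h0
        exact Subset.antisymm hall (by simpa using he)
      have := isOpen_interior (s := K)
      rw [hsub] at this
      exact not_isOpen_singleton (0 : E d) this
    obtain ⟨δ₁, hδ₁, hb₁⟩ := Metric.isOpen_iff.1 isOpen_interior e he
    obtain ⟨δ₂, hδ₂, hb₂⟩ := Metric.mem_nhds_iff.1 hV
    -- The bound `‖e‖` excludes `x = y`, the one intersection point that the cone condition permits.
    refine ⟨e, min (min δ₁ δ₂) ‖e‖, by positivity, fun x y α hα hx hy hxy => ?_⟩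
    simp only [lt_min_iff] at hx hy hxy
    by_contra! hcon
    have hk : α • (x - y) ∈ K := interior_subset (hb₁ (by
      rw [Metric.mem_ball, dist_eq_norm]; exact hxy.1.1))
    have hk' : x - y ∈ K := by
      have := hK α⁻¹ (inv_pos.2 hα) _ hk
      rwa [smul_smul, inv_mul_cancel₀ hα.ne', one_smul] at this
    have hmem := hKV y ⟨hb₂ hy.1.2, hcon.1⟩
      ⟨⟨⟨x - y, hk', by simp⟩, hcon.2⟩, hb₂ hx.1.2⟩
    have hxy' : x = y := hmem
    rw [hxy'] at hxy
    simp at hxy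
  · obtain ⟨δ, hδ, hb⟩ := Metric.isOpen_iff.1 isClosed_closure.isOpen_compl x₀ h2
    exact ⟨0, δ, hδ, fun x y α _ hx _ _ => Or.inr (hb hx)⟩

end

/-! ### Doubling of variables and the comparison principle. -/

section

variable {d : ℕ}

/-- Quantifies the strict growth of the Hamiltonian on the nonnegative orthant, even where some
components vanish. -/
theorem prod_add_prod_le_prod_add {ι : Type*} {s : Finset ι} (hs : s.Nonempty) {a b : ι → ℝ}
    (ha : ∀ i ∈ s, 0 ≤ a i) (hb : ∀ i ∈ s, 0 ≤ b i) :
    ∏ i ∈ s, a i + ∏ i ∈ s, b i ≤ ∏ i ∈ s, (a i + b i) := by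
  obtain ⟨i, hi⟩ := hs
  exact Finset.prod_add_prod_le hi le_rfl (fun j hj _ => by linarith [hb j hj])
    (fun j hj _ => by linarith [ha j hj]) ha hb

/-- Doubling of variables with a penalization that pushes `x - y` in the direction `e`, at a
maximum point `x₀` of `u - w`. -/
theorem exists_doubling {u w : E d → ℝ} {x₀ : E d} {r : ℝ} (hr : 0 < r)
    (hu : ContinuousOn u (Metric.closedBall x₀ r)) (hw : ContinuousOn w (Metric.closedBall x₀ r))
    (hmax : ∀ z ∈ Metric.closedBall x₀ r, u z - w z ≤ u x₀ - w x₀) (e : E d) {δ : ℝ}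
    (hδ : 0 < δ) :
    ∃ α : ℝ, 0 < α ∧ ∃ x y : E d, dist x x₀ < δ ∧ dist y x₀ < δ ∧ ‖α • (x - y) - e‖ < δ ∧
      ∀ x' ∈ Metric.closedBall x₀ r, ∀ y' ∈ Metric.closedBall x₀ r,
        u x' - w y' - ‖α • (x' - y') - e‖ ^ 2 - ‖x' - x₀‖ ^ 2 ≤
          u x - w y - ‖α • (x - y) - e‖ ^ 2 - ‖x - x₀‖ ^ 2 := by
  set B := Metric.closedBall x₀ r with hB
  have hBc : IsCompact B := isCompact_closedBall x₀ r
  have hx₀ : x₀ ∈ B := Metric.mem_closedBall_self hr.le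
  have hex : ∀ α : ℝ, ∃ z ∈ B ×ˢ B, ∀ z' ∈ B ×ˢ B,
      u z'.1 - w z'.2 - ‖α • (z'.1 - z'.2) - e‖ ^ 2 - ‖z'.1 - x₀‖ ^ 2 ≤
        u z.1 - w z.2 - ‖α • (z.1 - z.2) - e‖ ^ 2 - ‖z.1 - x₀‖ ^ 2 := by
    intro α
    refine (hBc.prod hBc).exists_isMaxOn ⟨(x₀, x₀), hx₀, hx₀⟩
      (f := fun z : E d × E d => u z.1 - w z.2 - ‖α • (z.1 - z.2) - e‖ ^ 2 - ‖z.1 - x₀‖ ^ 2) ?_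
    have h1 : ContinuousOn (fun z : E d × E d => u z.1) (B ×ˢ B) :=
      hu.comp continuousOn_fst fun z hz => hz.1
    have h2 : ContinuousOn (fun z : E d × E d => w z.2) (B ×ˢ B) :=
      hw.comp continuousOn_snd fun z hz => hz.2
    exact ((h1.sub h2).sub (by fun_prop)).sub (by fun_prop)
  choose Z hZ hZmax using hex
  obtain ⟨C₁, hC₁⟩ := hBc.exists_bound_of_continuousOn hu
  obtain ⟨C₂, hC₂⟩ := hBc.exists_bound_of_continuousOn hw
  simp only [Real.norm_eq_abs] at hC₁ hC₂
  have hlim : Tendsto (fun α : ℝ => x₀ + α⁻¹ • e) atTop (𝓝 x₀) := by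
    have : Tendsto (fun α : ℝ => x₀ + α⁻¹ • e) atTop (𝓝 (x₀ + (0 : ℝ) • e)) :=
      tendsto_const_nhds.add (tendsto_inv_atTop_zero.smul_const e)
    simpa using this
  have hnorm : Tendsto (fun α : ℝ => ‖α⁻¹ • e‖ ^ 2) atTop (𝓝 0) := by
    have h1 : Tendsto (fun α : ℝ => α⁻¹ • e) atTop (𝓝 ((0 : ℝ) • e)) :=
      tendsto_inv_atTop_zero.smul_const e
    simpa using (h1.norm.pow 2)
  have hBn : B ∈ 𝓝 x₀ := Metric.closedBall_mem_nhds x₀ hr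
  have hulim : Tendsto (fun α : ℝ => u (x₀ + α⁻¹ • e)) atTop (𝓝 (u x₀)) :=
    ((hu x₀ hx₀).continuousAt hBn).tendsto.comp hlim
  -- Compare the maximizer with the pair `(x₀ + α⁻¹ • e, x₀)`, for which the directional penalty is
  -- exactly zero, and use the maximality of `u - w` at `x₀`.
  have hbase : ∀ᶠ α : ℝ in atTop,
      ‖α • ((Z α).1 - (Z α).2) - e‖ ^ 2 + ‖(Z α).1 - x₀‖ ^ 2 ≤
        (w (Z α).1 - w (Z α).2) + (u x₀ - u (x₀ + α⁻¹ • e)) + ‖α⁻¹ • e‖ ^ 2 := by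
    filter_upwards [hlim.eventually hBn, eventually_gt_atTop 0] with α hα hpos
    have h1 := hZmax α (x₀ + α⁻¹ • e, x₀) ⟨hα, hx₀⟩
    have h2 := hmax _ (hZ α).1
    simp only [add_sub_cancel_left, smul_smul, mul_inv_cancel₀ hpos.ne', one_smul, sub_self,
      norm_zero] at h1
    linarith
  -- A bound independent of `α` suffices here: it forces the two points together at rate `1/α`, and
  -- then uniform continuity of `w` in `hbase` makes the penalties small.
  have hcrude : ∀ᶠ α : ℝ in atTop, ‖α • ((Z α).1 - (Z α).2) - e‖ ≤ 2 * C₁ + 2 * C₂ + 2 := by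
    filter_upwards [hbase, hlim.eventually hBn, hnorm.eventually_lt_const one_pos] with α h1 h2 h3
    have h4 := abs_le.1 (hC₂ _ (hZ α).1)
    have h5 := abs_le.1 (hC₂ _ (hZ α).2)
    have h6 := abs_le.1 (hC₁ _ hx₀)
    have h7 := abs_le.1 (hC₁ _ h2)
    nlinarith [sq_nonneg (‖α • ((Z α).1 - (Z α).2) - e‖ - 1), sq_nonneg ‖(Z α).1 - x₀‖]
  have hclose : ∀ ρ > 0, ∀ᶠ α : ℝ in atTop, dist (Z α).1 (Z α).2 < ρ := by
    intro ρ hρ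
    have h1 : Tendsto (fun α : ℝ => α⁻¹ * (2 * C₁ + 2 * C₂ + 2 + ‖e‖)) atTop (𝓝 0) := by
      simpa using tendsto_inv_atTop_zero.mul_const (2 * C₁ + 2 * C₂ + 2 + ‖e‖)
    filter_upwards [hcrude, h1.eventually_lt_const hρ, eventually_gt_atTop 0] with α h2 h3 hpos
    refine lt_of_le_of_lt ?_ h3
    rw [dist_eq_norm, inv_mul_eq_div, le_div_iff₀ hpos]
    have h4 : ‖α • ((Z α).1 - (Z α).2)‖ ≤ ‖α • ((Z α).1 - (Z α).2) - e‖ + ‖e‖ := by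
      simpa using norm_add_le (α • ((Z α).1 - (Z α).2) - e) e
    rw [norm_smul, Real.norm_eq_abs, abs_of_pos hpos] at h4
    linarith
  have hη : 0 < (δ / 2) ^ 2 / 3 := by positivity
  obtain ⟨ρ, hρ, hunif⟩ := Metric.uniformContinuousOn_iff.1
    (hBc.uniformContinuousOn_of_continuous hw) _ hη
  obtain ⟨α, hα, h1, h2, h3, h4, h5⟩ := (((eventually_gt_atTop (0 : ℝ)).and <| hbase.and <|
    (hclose ρ hρ).and <| (hclose (δ / 2) (by positivity)).and <|
    (hulim.eventually_const_lt (u := u x₀ - (δ / 2) ^ 2 / 3) (by linarith)).and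
      (hnorm.eventually_lt_const hη))).exists
  have h6 := hunif _ (hZ α).1 _ (hZ α).2 h2
  rw [Real.dist_eq] at h6
  have h7 := (abs_lt.1 h6).2
  have h8 : ‖α • ((Z α).1 - (Z α).2) - e‖ ^ 2 + ‖(Z α).1 - x₀‖ ^ 2 < (δ / 2) ^ 2 := by linarith
  have h9 : ‖α • ((Z α).1 - (Z α).2) - e‖ < δ / 2 :=
    lt_of_pow_lt_pow_left₀ 2 (by positivity) (by nlinarith [sq_nonneg ‖(Z α).1 - x₀‖])
  have h10 : ‖(Z α).1 - x₀‖ < δ / 2 :=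
    lt_of_pow_lt_pow_left₀ 2 (by positivity)
      (by nlinarith [sq_nonneg ‖α • ((Z α).1 - (Z α).2) - e‖])
  refine ⟨α, hα, (Z α).1, (Z α).2, ?_, ?_, by linarith, fun x' hx' y' hy' =>
    hZmax α (x', y') ⟨hx', hy'⟩⟩
  · rw [dist_eq_norm]; linarith
  · have := dist_triangle_left (Z α).2 x₀ (Z α).1
    rw [dist_eq_norm (Z α).1 x₀] at this
    linarith

/-- Local comparison: a strictly perturbed difference of a subsolution and a Pareto-monotone
supersolution has no local maximum. -/
theorem not_isLocalMax_sub (hd : 2 ≤ d) {Ω : Set (E d)} {f : E d → ℝ} {M : ℝ}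
    (hf : IsWeight Ω f M) (hc : ConeCondition Ω) (hm : HasModulusOn Ω f) {O : Set (E d)}
    (hO : IsOpen O) {u w : E d → ℝ} (hu : IsViscSub O prodH f u) (hw : IsViscSuper O prodH f w)
    (hmono : ParetoMonotoneOn O w) {ε : ℝ} (hε : 0 < ε) {x₀ : E d} (hx₀ : x₀ ∈ O)
    (hmax : ∀ z ∈ O, u z - (w z + ε * ∑ i, z i) ≤ u x₀ - (w x₀ + ε * ∑ i, x₀ i)) : False := by
  obtain ⟨e, δ₁, hδ₁, hdir⟩ := hc.exists_direction hd hf.isOpen x₀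
  have hη : 0 < (ε / 2) ^ d / 2 := by positivity
  obtain ⟨ρ, hρ, hunif⟩ := hm.exists_uniform hη
  obtain ⟨r, hr, hball⟩ := Metric.nhds_basis_closedBall.mem_iff.1 (hO.mem_nhds hx₀)
  -- `δ₁` serves the cone direction, `ρ / 2` puts `x` and `y` within `ρ`, `ε / 4` lets the
  -- localizing gradient `2(x - x₀)` use up at most half of `ε`, and `r` keeps both points interior
  -- to the ball.
  set δ := min (min δ₁ (ρ / 2)) (min (ε / 4) r) with hδdef
  have hδ : 0 < δ := by positivity
  have hwc : ContinuousOn (fun z : E d => w z + ε * ∑ i, z i) (Metric.closedBall x₀ r) :=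
    (hw.1.mono hball).add (by fun_prop)
  obtain ⟨α, hα, x, y, hx, hy, hxy, hΦ⟩ := exists_doubling hr (hu.1.mono hball) hwc
    (fun z hz => hmax z (hball hz)) e hδ
  have hδ' : δ ≤ δ₁ ∧ δ ≤ ρ / 2 ∧ δ ≤ ε / 4 ∧ δ ≤ r := by
    simp [hδdef]
  obtain ⟨hd1, hd2, hd3, hd4⟩ := hδ'
  have hxb : x ∈ Metric.ball x₀ r := lt_of_lt_of_le hx hd4
  have hyb : y ∈ Metric.ball x₀ r := lt_of_lt_of_le hy hd4
  have hxO : x ∈ O := hball (Metric.ball_subset_closedBall hxb)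
  have hyO : y ∈ O := hball (Metric.ball_subset_closedBall hyb)
  set a := α • (x - y) - e with ha
  set P : E d := (2 * α) • a with hP
  set one : E d := WithLp.toLp 2 fun _ => 1 with hone
  have hinner_one : ∀ z : E d, inner ℝ one z = ∑ i, z i := by
    intro z
    simp [PiLp.inner_apply, hone]
  -- With `y` frozen, the penalties are quadratic in the first variable, so their gradient is a
  -- supergradient with remainder `(α ^ 2 + 1) ‖z - x‖²`.
  have hsup : P + (2 : ℝ) • (x - x₀) ∈ superDiff O u x := by
    refine mem_superDiff_of_quadratic hO hxO (α ^ 2 + 1) ?_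
    filter_upwards [Metric.isOpen_ball.mem_nhds hxb] with z hz
    have h1 := hΦ z (Metric.ball_subset_closedBall hz) y (Metric.ball_subset_closedBall hyb)
    have h2 : α • (z - y) - e = a + α • (z - x) := by rw [ha]; module
    have h3 : z - x₀ = (x - x₀) + (z - x) := by abel
    rw [h2, h3, norm_add_sq_real, norm_add_sq_real, norm_smul, inner_smul_right, mul_pow,
      Real.norm_eq_abs, sq_abs] at h1
    rw [hP, inner_add_left, inner_smul_left, inner_smul_left]
    simp only [conj_trivial]
    nlinarith
  have hsub : P - ε • one ∈ subDiff O w y := by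
    refine mem_subDiff_of_quadratic hO hyO (α ^ 2) ?_
    filter_upwards [Metric.isOpen_ball.mem_nhds hyb] with z hz
    have h1 := hΦ x (Metric.ball_subset_closedBall hxb) z (Metric.ball_subset_closedBall hz)
    have h2 : α • (x - z) - e = a - α • (z - y) := by rw [ha]; module
    rw [h2, norm_sub_sq_real, norm_smul, inner_smul_right, mul_pow,
      Real.norm_eq_abs, sq_abs] at h1
    rw [hP, inner_sub_left, inner_smul_left, inner_smul_left, hinner_one]
    simp only [conj_trivial, PiLp.sub_apply, Finset.sum_sub_distrib]
    nlinarith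
  have h1 := hu.2 x hxO _ hsup
  have h2 := hw.2 y hyO _ hsub
  have hnn := nonneg_of_mem_subDiff hO hmono hyO hsub
  rw [hf.lscEnv_eq hO hyO] at h2
  -- Each component of the supergradient at `x` exceeds that of the subgradient at `y` by at least
  -- `ε / 2`.
  have h3 : f y + (ε / 2) ^ d ≤ uscEnv O f x := by
    refine le_trans ?_ h1
    have hne : (Finset.univ : Finset (Fin d)).Nonempty := ⟨⟨0, by omega⟩, Finset.mem_univ _⟩
    have h4 := prod_add_prod_le_prod_add hne (a := fun i => (P - ε • one) i)
      (b := fun _ => ε / 2) (fun i _ => hnn i) (fun _ _ => by positivity)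
    simp only [Finset.prod_const, Finset.card_univ, Fintype.card_fin] at h4
    refine (add_le_add_left h2 _).trans (h4.trans ?_)
    refine Finset.prod_le_prod (fun i _ => by have := hnn i; positivity) fun i _ => ?_
    have h5 : |(x - x₀) i| ≤ ‖x - x₀‖ := by
      simpa using PiLp.norm_apply_le (x - x₀) i
    rw [← dist_eq_norm] at h5
    have h6 := (abs_le.1 h5).1
    simp only [PiLp.sub_apply, PiLp.add_apply, PiLp.smul_apply, smul_eq_mul, hone] at h6 ⊢
    linarith
  have hpos : 0 < (ε / 2) ^ d := by positivity
  -- Inside `Ω`, points near `x` are either controlled by the modulus or carry `f = 0 ≤ f y`.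
  -- Outside, the chosen direction puts `x` off `closure Ω`, where `f` vanishes nearby.
  by_cases hyΩ : y ∈ Ω
  · have h4 : uscEnv O f x ≤ f y + (ε / 2) ^ d / 2 := by
      refine hf.uscEnv_le hO hxO ?_
      have hxy' : dist x y < ρ := by
        have := dist_triangle_right x y x₀
        linarith
      filter_upwards [Metric.isOpen_ball.mem_nhds (show x ∈ Metric.ball y ρ from hxy')] with z hz
      by_cases hzΩ : z ∈ Ω
      · linarith [(abs_le.1 (hunif z hzΩ y hyΩ hz)).2]
      · rw [hf.eq_zero z hzΩ]
        have := hf.nonneg y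
        positivity
    linarith
  · have h4 : uscEnv O f x ≤ 0 := by
      refine hf.uscEnv_le hO hxO ?_
      have h5 := (hdir x y α hα (hx.trans_le hd1) (hy.trans_le hd1)
        (hxy.trans_le hd1)).resolve_left hyΩ
      filter_upwards [isClosed_closure.isOpen_compl.mem_nhds h5] with z hz
      exact (hf.eq_zero z fun h => hz (subset_closure h)).le
    have := hf.nonneg y
    linarith

/-- Comparison principle for Pareto-monotone solutions satisfying the truncation condition. -/
theorem IsParetoSolution.le (hd : 2 ≤ d) {Ω : Set (E d)} {f : E d → ℝ} {M : ℝ}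
    (hf : IsWeight Ω f M) (hc : ConeCondition Ω) (hm : HasModulusOn Ω f) {u w : E d → ℝ}
    (hu : IsParetoSolution f u) (hw : IsParetoSolution f w) {x : E d}
    (hx : x ∈ closure (orthant d)) : u x ≤ w x := by
  by_contra! hlt
  have hxO : x ∈ orthant d := by
    refine mem_orthant_of_not_mem_frontier hx fun h => ?_
    rw [hu.boundary x h, hw.boundary x h] at hlt
    exact lt_irrefl _ hlt
  rw [hu.truncation x hxO, hw.truncation x hxO] at hlt
  set y := truncOne x with hy
  have hyO : y ∈ orthant d := truncOne_mem_orthant hxO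
  obtain ⟨ε, hε, hεy⟩ : ∃ ε > 0, 0 < u y - (w y + ε * ∑ i, y i) := by
    have hsum : 0 ≤ ∑ i, y i := Finset.sum_nonneg fun i _ => (hyO i).le
    refine ⟨(u y - w y) / (∑ i, y i + 1), by apply div_pos <;> linarith, ?_⟩
    have h1 : (u y - w y) / (∑ i, y i + 1) * ∑ i, y i < u y - w y := by
      rw [div_mul_eq_mul_div, div_lt_iff₀ (by linarith)]
      nlinarith
    linarith
  have hQ : IsCompact (closure (orthant d) ∩ unitCube d) :=
    (isCompact_unitCube d).inter_left isClosed_closure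
  have hcont : ContinuousOn (fun z : E d => u z - (w z + ε * ∑ i, z i))
      (closure (orthant d) ∩ unitCube d) :=
    (hu.continuousOn.mono inter_subset_left).sub
      ((hw.continuousOn.mono inter_subset_left).add (by fun_prop))
  obtain ⟨x₀, hx₀, hmax⟩ := hQ.exists_isMaxOn
    ⟨y, subset_closure hyO, truncOne_mem_unitCube hxO⟩ hcont
  have hx₀pos : 0 < u x₀ - (w x₀ + ε * ∑ i, x₀ i) :=
    hεy.trans_le (hmax ⟨subset_closure hyO, truncOne_mem_unitCube hxO⟩)
  have hx₀O : x₀ ∈ orthant d := by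
    refine mem_orthant_of_not_mem_frontier hx₀.1 fun h => ?_
    rw [hu.boundary _ h, hw.boundary _ h] at hx₀pos
    have : 0 ≤ ∑ i, x₀ i := Finset.sum_nonneg fun i _ => nonneg_of_mem_closure_orthant hx₀.1 i
    nlinarith [mul_nonneg hε.le this]
  -- The maximum over the cube is one over the whole orthant: truncation leaves `u` and `w`
  -- unchanged and only lowers `ε * ∑ i, z i`.
  refine not_isLocalMax_sub hd hf hc hm (isOpen_orthant d) hu.viscosity.1 hw.viscosity.2
    hw.monotone hε hx₀O fun z hz => ?_
  have h1 : u (truncOne z) - (w (truncOne z) + ε * ∑ i, truncOne z i) ≤ _ :=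
    hmax ⟨subset_closure (truncOne_mem_orthant hz), truncOne_mem_unitCube hz⟩
  rw [hu.truncation z hz, hw.truncation z hz]
  have h2 : ∑ i, truncOne z i ≤ ∑ i, z i := Finset.sum_le_sum fun i _ => min_le_left _ _
  have h3 := mul_le_mul_of_nonneg_left h2 hε.le
  simp only at h1
  linarith

end

/-! ### Admissible curves, Hölder estimates in boxes, and finiteness of the value function. -/

section

variable {d : ℕ}

/-- The integrand of the energy at position `x` and velocity `v`. -/
def lagrangian (f : E d → ℝ) (x : E d) (v : Fin d → ℝ) : ℝ :=
  f x ^ (1 / (d : ℝ)) * (∏ i, v i) ^ (1 / (d : ℝ))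

theorem energy_eq (f : E d → ℝ) (γ : ℝ → E d) :
    energy f γ = ∫ t in (0 : ℝ)..1, lagrangian f (γ t) (velocity γ t) := rfl

/-- Restricts energies to the times where `f` is nonzero along the curve; no measurability of `t` is
needed. -/
theorem lintegral_le_of_support {α : Type*} [MeasurableSpace α] {μ : Measure α} {s t : Set α}
    (hs : MeasurableSet s) {F : α → ENNReal} (h : ∀ x ∈ s, F x ≠ 0 → x ∈ t) :
    ∫⁻ x in s, F x ∂μ ≤ ∫⁻ x in t, F x ∂μ := by
  classical
  calc ∫⁻ x in s, F x ∂μ ≤ ∫⁻ x in s, t.indicator F x ∂μ := by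
        refine setLIntegral_mono' hs fun x hx => ?_
        by_cases h0 : F x = 0
        · simp [h0]
        · rw [indicator_of_mem (h x hx h0)]
    _ ≤ ∫⁻ x, t.indicator F x ∂μ := setLIntegral_le_lintegral _ _
    _ ≤ ∫⁻ x in t, F x ∂μ := lintegral_indicator_le _ _

namespace Admissible

variable {γ : ℝ → E d}

theorem continuousOn (hγ : Admissible γ) : ContinuousOn γ (Icc 0 1) := hγ.1.continuousOn

theorem continuousOn_apply (hγ : Admissible γ) (i : Fin d) :
    ContinuousOn (fun t => γ t i) (Icc 0 1) :=
  (EuclideanSpace.proj i : E d →L[ℝ] ℝ).continuous.comp_continuousOn hγ.continuousOn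

theorem continuousOn_velocity (hγ : Admissible γ) : ContinuousOn (velocity γ) (Icc 0 1) :=
  hγ.1.continuousOn_derivWithin (uniqueDiffOn_Icc zero_lt_one) le_rfl

theorem continuousOn_velocity_apply (hγ : Admissible γ) (i : Fin d) :
    ContinuousOn (fun t => velocity γ t i) (Icc 0 1) :=
  (EuclideanSpace.proj i : E d →L[ℝ] ℝ).continuous.comp_continuousOn hγ.continuousOn_velocity

theorem velocity_nonneg (hγ : Admissible γ) {t : ℝ} (ht : t ∈ Icc (0 : ℝ) 1) (i : Fin d) :
    0 ≤ velocity γ t i := (hγ.2 t ht).1 i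

theorem hasDerivWithinAt_apply (hγ : Admissible γ) {t : ℝ} (ht : t ∈ Icc (0 : ℝ) 1) (i : Fin d) :
    HasDerivWithinAt (fun s => γ s i) (velocity γ t i) (Icc 0 1) t := by
  have h1 : HasDerivWithinAt γ (velocity γ t) (Icc 0 1) t :=
    ((hγ.1.differentiableOn one_ne_zero) t ht).hasDerivWithinAt
  exact (EuclideanSpace.proj i : E d →L[ℝ] ℝ).hasFDerivAt.comp_hasDerivWithinAt t h1

theorem intervalIntegrable_velocity (hγ : Admissible γ) {a b : ℝ} (ha : 0 ≤ a) (hab : a ≤ b)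
    (hb : b ≤ 1) (i : Fin d) : IntervalIntegrable (fun t => velocity γ t i) volume a b := by
  refine ContinuousOn.intervalIntegrable ?_
  rw [uIcc_of_le hab]
  exact (hγ.continuousOn_velocity_apply i).mono (Icc_subset_Icc ha hb)

theorem integral_velocity (hγ : Admissible γ) {a b : ℝ} (ha : 0 ≤ a) (hab : a ≤ b) (hb : b ≤ 1)
    (i : Fin d) : ∫ t in a..b, velocity γ t i = γ b i - γ a i := by
  refine intervalIntegral.integral_eq_sub_of_hasDerivAt_of_le hab
    ((hγ.continuousOn_apply i).mono (Icc_subset_Icc ha hb)) (fun t ht => ?_)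
    (hγ.intervalIntegrable_velocity ha hab hb i)
  have ht' : t ∈ Ioo (0 : ℝ) 1 := ⟨ha.trans_lt ht.1, ht.2.trans_le hb⟩
  exact (hγ.hasDerivWithinAt_apply (Ioo_subset_Icc_self ht') i).hasDerivAt
    (Icc_mem_nhds ht'.1 ht'.2)

theorem lintegral_velocity (hγ : Admissible γ) {a b : ℝ} (ha : 0 ≤ a) (hab : a ≤ b) (hb : b ≤ 1)
    (i : Fin d) :
    ∫⁻ t in Icc a b, ENNReal.ofReal (velocity γ t i) = ENNReal.ofReal (γ b i - γ a i) := by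
  have hint := (hγ.intervalIntegrable_velocity ha hab hb i)
  rw [intervalIntegrable_iff_integrableOn_Icc_of_le hab] at hint
  rw [← hγ.integral_velocity ha hab hb i, intervalIntegral.integral_of_le hab,
    ← integral_Icc_eq_integral_Ioc, ofReal_integral_eq_lintegral_ofReal hint]
  filter_upwards [ae_restrict_mem measurableSet_Icc] with t ht
  exact hγ.velocity_nonneg (Icc_subset_Icc ha hb ht) i

theorem monotone (hγ : Admissible γ) {a b : ℝ} (ha : 0 ≤ a) (hab : a ≤ b) (hb : b ≤ 1) :
    CompLE (γ a) (γ b) := by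
  intro i
  rw [← sub_nonneg, ← hγ.integral_velocity ha hab hb i]
  exact intervalIntegral.integral_nonneg hab fun t ht =>
    hγ.velocity_nonneg (Icc_subset_Icc ha hb ht) i

/-- The times an admissible curve spends inside a box form a compact set. -/
theorem isCompact_preimage_box (hγ : Admissible γ) (lo hi : E d) :
    IsCompact {t ∈ Icc (0 : ℝ) 1 | CompLE lo (γ t) ∧ CompLE (γ t) hi} := by
  have hC : IsClosed {z : E d | CompLE lo z ∧ CompLE z hi} := by
    have : {z : E d | CompLE lo z ∧ CompLE z hi} = ⋂ i, {z : E d | lo i ≤ z i ∧ z i ≤ hi i} := by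
      ext z
      simp [CompLE, forall_and]
    rw [this]
    refine isClosed_iInter fun i => ?_
    have h1 : IsClosed {z : E d | lo i ≤ z i} := isClosed_le continuous_const (by fun_prop)
    have h2 : IsClosed {z : E d | z i ≤ hi i} := isClosed_le (by fun_prop) continuous_const
    exact h1.inter h2
  exact isCompact_Icc.of_isClosed_subset
    (hγ.continuousOn.preimage_isClosed_of_isClosed isClosed_Icc hC) fun t ht => ht.1

/-- The first and last times in the box are attained by compactness, and the integral of the
velocity between them telescopes to a difference of two positions in the box. -/
theorem lintegral_velocity_box_le (hγ : Admissible γ) (lo hi : E d) (i : Fin d) :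
    ∫⁻ t in {t ∈ Icc (0 : ℝ) 1 | CompLE lo (γ t) ∧ CompLE (γ t) hi},
      ENNReal.ofReal (velocity γ t i) ≤ ENNReal.ofReal (hi i - lo i) := by
  set S := {t ∈ Icc (0 : ℝ) 1 | CompLE lo (γ t) ∧ CompLE (γ t) hi} with hS
  rcases S.eq_empty_or_nonempty with h | hne
  · simp [h]
  · have hc := hγ.isCompact_preimage_box lo hi
    have ha := hc.sInf_mem hne
    have hb := hc.sSup_mem hne
    have hab : sInf S ≤ sSup S := csInf_le_csSup hne hc.bddBelow hc.bddAbove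
    calc ∫⁻ t in S, ENNReal.ofReal (velocity γ t i)
        ≤ ∫⁻ t in Icc (sInf S) (sSup S), ENNReal.ofReal (velocity γ t i) :=
          lintegral_mono_set fun t ht => ⟨csInf_le hc.bddBelow ht, le_csSup hc.bddAbove ht⟩
      _ = ENNReal.ofReal (γ (sSup S) i - γ (sInf S) i) :=
          hγ.lintegral_velocity ha.1.1 hab hb.1.2 i
      _ ≤ ENNReal.ofReal (hi i - lo i) :=
          ENNReal.ofReal_le_ofReal (sub_le_sub (hb.2.2 i) (ha.2.1 i))

variable [NeZero d]

/-- Hölder bound for the energy of the part of an admissible curve inside a box. -/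
theorem lintegral_lagrangian_box_le (hγ : Admissible γ) {f : E d → ℝ} (hf : ∀ x, 0 ≤ f x)
    {lo hi : E d} (hle : CompLE lo hi) {c : ℝ}
    (hc : ∀ t ∈ Icc (0 : ℝ) 1, CompLE lo (γ t) → CompLE (γ t) hi → f (γ t) ≤ c) :
    ∫⁻ t in {t ∈ Icc (0 : ℝ) 1 | CompLE lo (γ t) ∧ CompLE (γ t) hi},
      ENNReal.ofReal (lagrangian f (γ t) (velocity γ t)) ≤
        ENNReal.ofReal (c ^ (1 / (d : ℝ)) * (∏ i, (hi i - lo i)) ^ (1 / (d : ℝ))) := by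
  set S := {t ∈ Icc (0 : ℝ) 1 | CompLE lo (γ t) ∧ CompLE (γ t) hi} with hS
  have hSm : MeasurableSet S := (hγ.isCompact_preimage_box lo hi).measurableSet
  rcases S.eq_empty_or_nonempty with h | ⟨t₀, ht₀⟩
  · simp [h]
  have hc0 : 0 ≤ c := (hf _).trans (hc t₀ ht₀.1 ht₀.2.1 ht₀.2.2)
  have hd : 0 ≤ 1 / (d : ℝ) := by positivity
  have hroot : ∀ a : Fin d → ℝ, (∀ i, 0 ≤ a i) →
      ENNReal.ofReal ((∏ i, a i) ^ (1 / (d : ℝ))) = ∏ i, ENNReal.ofReal (a i) ^ (1 / (d : ℝ)) := by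
    intro a ha
    rw [← Real.finsetProd_rpow _ _ fun i _ => ha i,
      ENNReal.ofReal_prod_of_nonneg fun i _ => Real.rpow_nonneg (ha i) _]
    exact Finset.prod_congr rfl fun i _ => (ENNReal.ofReal_rpow_of_nonneg (ha i) hd).symm
  calc ∫⁻ t in S, ENNReal.ofReal (lagrangian f (γ t) (velocity γ t))
      ≤ ∫⁻ t in S, ENNReal.ofReal (c ^ (1 / (d : ℝ))) *
          ∏ i, ENNReal.ofReal (velocity γ t i) ^ (1 / (d : ℝ)) := by
        refine setLIntegral_mono' hSm fun t ht => ?_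
        rw [← hroot _ fun i => hγ.velocity_nonneg ht.1 i,
          ← ENNReal.ofReal_mul (Real.rpow_nonneg hc0 _)]
        refine ENNReal.ofReal_le_ofReal (mul_le_mul_of_nonneg_right ?_ ?_)
        · exact Real.rpow_le_rpow (hf _) (hc t ht.1 ht.2.1 ht.2.2) hd
        · exact Real.rpow_nonneg (Finset.prod_nonneg fun i _ => hγ.velocity_nonneg ht.1 i) _
    _ = ENNReal.ofReal (c ^ (1 / (d : ℝ))) *
          ∫⁻ t in S, ∏ i, ENNReal.ofReal (velocity γ t i) ^ (1 / (d : ℝ)) :=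
        lintegral_const_mul' _ _ ENNReal.ofReal_ne_top
    _ ≤ ENNReal.ofReal (c ^ (1 / (d : ℝ))) *
          ∏ i, (∫⁻ t in S, ENNReal.ofReal (velocity γ t i)) ^ (1 / (d : ℝ)) := by
        -- Generalized Hölder inequality for `d` factors, each with exponent `1 / d`; the exponents
        -- sum to one.
        gcongr
        refine ENNReal.lintegral_prod_norm_pow_le _ (fun i _ => ?_) ?_ fun _ _ => hd
        · refine ENNReal.measurable_ofReal.comp_aemeasurable ?_
          exact ((hγ.continuousOn_velocity_apply i).mono fun t ht => ht.1).aemeasurable hSm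
        · have : (d : ℝ) ≠ 0 := NeZero.ne _
          simp [this]
    _ ≤ ENNReal.ofReal (c ^ (1 / (d : ℝ))) *
          ∏ i, ENNReal.ofReal (hi i - lo i) ^ (1 / (d : ℝ)) := by
        gcongr with i
        exact hγ.lintegral_velocity_box_le lo hi i
    _ = _ := by
        rw [← hroot _ fun i => sub_nonneg.2 (hle i), ← ENNReal.ofReal_mul (Real.rpow_nonneg hc0 _)]

end Admissible

theorem IsWeight.measurable {Ω : Set (E d)} {f : E d → ℝ} {M : ℝ} (hf : IsWeight Ω f M) :
    Measurable f := by
  refine measurable_of_Ioi fun a => ?_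
  by_cases ha : a < 0
  · convert MeasurableSet.univ
    ext x
    simp [ha.trans_le (hf.nonneg x)]
  · have : f ⁻¹' Ioi a = Ω ∩ f ⁻¹' Ioi a := by
      ext x
      simp only [mem_inter_iff, mem_preimage, mem_Ioi, iff_and_self]
      exact fun h => hf.mem_of_pos ((not_lt.1 ha).trans_lt h)
    rw [this]
    exact (hf.continuousOn.isOpen_inter_preimage hf.isOpen isOpen_Ioi).measurableSet

theorem lagrangian_nonneg {f : E d → ℝ} (hf : ∀ x, 0 ≤ f x) (x : E d) {v : Fin d → ℝ}
    (hv : ∀ i, 0 ≤ v i) : 0 ≤ lagrangian f x v :=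
  mul_nonneg (Real.rpow_nonneg (hf x) _)
    (Real.rpow_nonneg (Finset.prod_nonneg fun i _ => hv i) _)

theorem lagrangian_eq_zero [NeZero d] {f : E d → ℝ} {x : E d} (hx : f x = 0) (v : Fin d → ℝ) :
    lagrangian f x v = 0 := by
  have : (1 / (d : ℝ)) ≠ 0 := one_div_ne_zero (NeZero.ne _)
  rw [lagrangian, hx, Real.zero_rpow this, zero_mul]

variable {Ω : Set (E d)} {f : E d → ℝ} {M : ℝ} {γ : ℝ → E d}

theorem Admissible.energy_nonneg (hγ : Admissible γ) (hf : ∀ x, 0 ≤ f x) : 0 ≤ energy f γ := by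
  rw [energy_eq]
  exact intervalIntegral.integral_nonneg zero_le_one fun t ht =>
    lagrangian_nonneg hf _ fun i => hγ.velocity_nonneg ht i

theorem valueFn_le {x : E d} {C : ℝ} (hC : 0 ≤ C)
    (h : ∀ γ : ℝ → E d, Admissible γ → CompLE (γ 1) x → energy f γ ≤ C) : valueFn f x ≤ C := by
  refine Real.sSup_le ?_ hC
  rintro _ ⟨γ, hγ, hx, rfl⟩
  exact h γ hγ hx

theorem valueFn_nonneg (hf : ∀ x, 0 ≤ f x) (x : E d) : 0 ≤ valueFn f x := by
  refine Real.sSup_nonneg ?_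
  rintro _ ⟨γ, hγ, -, rfl⟩
  exact hγ.energy_nonneg hf

variable [NeZero d]

theorem IsWeight.ofReal_energy (hf : IsWeight Ω f M) (hγ : Admissible γ) :
    ENNReal.ofReal (energy f γ) =
      ∫⁻ t in Icc (0 : ℝ) 1, ENNReal.ofReal (lagrangian f (γ t) (velocity γ t)) := by
  have hnn : 0 ≤ᵐ[volume.restrict (Icc (0 : ℝ) 1)]
      fun t => lagrangian f (γ t) (velocity γ t) := by
    filter_upwards [ae_restrict_mem measurableSet_Icc] with t ht
    exact lagrangian_nonneg hf.nonneg _ fun i => hγ.velocity_nonneg ht i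
  have hmeas : AEStronglyMeasurable (fun t => lagrangian f (γ t) (velocity γ t))
      (volume.restrict (Icc (0 : ℝ) 1)) := by
    refine AEMeasurable.aestronglyMeasurable (AEMeasurable.mul ?_ ?_)
    · exact (hf.measurable.comp_aemeasurable
        (hγ.continuousOn.aemeasurable measurableSet_Icc)).pow_const _
    · refine AEMeasurable.pow_const ?_ _
      exact Finset.aemeasurable_fun_prod _ fun i _ =>
        (hγ.continuousOn_velocity_apply i).aemeasurable measurableSet_Icc
  -- By monotonicity the curve stays in the box with corners `γ 0` and `γ 1`, so the Hölder bound
  -- applies.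
  have hfin : ∫⁻ t in Icc (0 : ℝ) 1, ENNReal.ofReal (lagrangian f (γ t) (velocity γ t)) ≠ ⊤ := by
    refine ne_top_of_le_ne_top ENNReal.ofReal_ne_top
      ((lintegral_mono_set fun t ht => ?_).trans (hγ.lintegral_lagrangian_box_le hf.nonneg
        (hγ.monotone le_rfl zero_le_one le_rfl) (c := M) fun t _ _ _ => hf.le _))
    exact ⟨ht, hγ.monotone le_rfl ht.1 ht.2, hγ.monotone ht.1 ht.2 le_rfl⟩
  rw [energy_eq, intervalIntegral.integral_of_le zero_le_one, ← integral_Icc_eq_integral_Ioc,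
    integral_eq_lintegral_of_nonneg_ae hnn hmeas, ENNReal.ofReal_toReal hfin]

/-- Energy bound for a weight supported in the unit cube. -/
theorem IsWeight.energy_le (hf : IsWeight Ω f M) (hs : ∀ x, f x ≠ 0 → x ∈ unitCube d)
    (hγ : Admissible γ) : energy f γ ≤ M ^ (1 / (d : ℝ)) := by
  have hM : 0 ≤ M := (hf.nonneg 0).trans (hf.le 0)
  rw [← ENNReal.ofReal_le_ofReal_iff (Real.rpow_nonneg hM _), hf.ofReal_energy hγ]
  have h1 := hγ.lintegral_lagrangian_box_le hf.nonneg (lo := 0) (hi := WithLp.toLp 2 fun _ => 1)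
    (fun i => by simp) (c := M) fun t _ _ _ => hf.le _
  simp only [PiLp.zero_apply, sub_zero, Finset.prod_const_one, Real.one_rpow, mul_one] at h1
  refine (lintegral_le_of_support measurableSet_Icc fun t ht hne => ?_).trans h1
  have hcube := hs (γ t) fun h0 => hne (by simp [lagrangian_eq_zero h0])
  exact ⟨ht, fun i => (hcube i).1, fun i => (hcube i).2⟩

/-- Needed for `valueFn` to be a true supremum, since the real `sSup` of an unbounded set is `0`. -/
theorem IsWeight.bddAbove (hf : IsWeight Ω f M) (hs : ∀ x, f x ≠ 0 → x ∈ unitCube d) (x : E d) :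
    BddAbove {J | ∃ γ : ℝ → E d, Admissible γ ∧ CompLE (γ 1) x ∧ J = energy f γ} := by
  refine ⟨M ^ (1 / (d : ℝ)), ?_⟩
  rintro _ ⟨γ, hγ, -, rfl⟩
  exact hf.energy_le hs hγ

theorem IsWeight.energy_le_valueFn (hf : IsWeight Ω f M) (hs : ∀ x, f x ≠ 0 → x ∈ unitCube d)
    (hγ : Admissible γ) {x : E d} (hx : CompLE (γ 1) x) : energy f γ ≤ valueFn f x :=
  le_csSup (hf.bddAbove hs x) ⟨γ, hγ, hx, rfl⟩

theorem IsWeight.valueFn_mono (hf : IsWeight Ω f M) (hs : ∀ x, f x ≠ 0 → x ∈ unitCube d)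
    {x y : E d} (hxy : CompLE x y) : valueFn f x ≤ valueFn f y :=
  valueFn_le (valueFn_nonneg hf.nonneg y) fun _ hγ hx =>
    hf.energy_le_valueFn hs hγ fun i => (hx i).trans (hxy i)

end

/-! ### Curves with integrable velocity. -/

section

variable {d : ℕ}

/-- The curve with velocity `v` that reaches `x` at time `T`. -/
def endCurve (x : E d) (T : ℝ) (v : ℝ → Fin d → ℝ) (t : ℝ) : E d :=
  WithLp.toLp 2 fun i => x i - ∫ s in t..T, v s i

theorem endCurve_apply (x : E d) (T : ℝ) (v : ℝ → Fin d → ℝ) (t : ℝ) (i : Fin d) :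
    endCurve x T v t i = x i - ∫ s in t..T, v s i := rfl

theorem hasDerivAt_endCurve {v : ℝ → Fin d → ℝ} (hv : Continuous v) (x : E d) (T t : ℝ) :
    HasDerivAt (endCurve x T v) (WithLp.toLp 2 (v t)) t := by
  have h1 : HasDerivAt (fun t i => x i - ∫ s in t..T, v s i) (v t) t := by
    rw [hasDerivAt_pi]
    intro i
    have hvi : Continuous fun s => v s i := (continuous_apply i).comp hv
    have h2 := (hvi.integral_hasStrictDerivAt T t).hasDerivAt.const_add (x i)
    refine h2.congr_of_eventuallyEq (Eventually.of_forall fun s => ?_)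
    simp only
    rw [intervalIntegral.integral_symm T s, sub_neg_eq_add]
  exact (PiLp.hasFDerivAt_toLp (𝕜 := ℝ) 2 _).comp_hasDerivAt t h1

theorem continuous_endCurve {v : ℝ → Fin d → ℝ} (hv : Continuous v) (x : E d) (T : ℝ) :
    Continuous (endCurve x T v) :=
  continuous_iff_continuousAt.2 fun t => (hasDerivAt_endCurve hv x T t).continuousAt

theorem rpow_prod_mul [NeZero d] {v : Fin d → ℝ} (hv : ∀ i, 0 ≤ v i) {T : ℝ} (hT : 0 ≤ T) :
    (∏ i, T * v i) ^ (1 / (d : ℝ)) = T * (∏ i, v i) ^ (1 / (d : ℝ)) := by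
  have hd : (d : ℝ) ≠ 0 := NeZero.ne _
  have h1 : (∏ i, T * v i) = T ^ d * ∏ i, v i := by
    rw [Finset.prod_mul_distrib]; simp
  rw [h1, Real.mul_rpow (by positivity) (Finset.prod_nonneg fun i _ => hv i),
    ← Real.rpow_natCast, ← Real.rpow_mul hT, mul_one_div_cancel hd, Real.rpow_one]

theorem lagrangian_smul [NeZero d] (f : E d → ℝ) (x : E d) {v : Fin d → ℝ} (hv : ∀ i, 0 ≤ v i)
    {T : ℝ} (hT : 0 ≤ T) : lagrangian f x (fun i => T * v i) = T * lagrangian f x v := by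
  rw [lagrangian, lagrangian, rpow_prod_mul hv hT]
  ring

theorem continuous_rpow_one_div [NeZero d] : Continuous fun t : ℝ => t ^ (1 / (d : ℝ)) :=
  Real.continuous_rpow_const (by positivity)

variable {Ω : Set (E d)} {f : E d → ℝ} {M : ℝ} {γ : ℝ → E d}

theorem Admissible.endCurve_velocity (hγ : Admissible γ) {t t₀ : ℝ} (h0 : 0 ≤ t) (h : t ≤ t₀)
    (h1 : t₀ ≤ 1) : endCurve (γ t₀) t₀ (fun s => velocity γ s) t = γ t := by
  ext i
  rw [endCurve_apply, hγ.integral_velocity h0 h h1, sub_sub_cancel]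

theorem Admissible.integrableOn_velocity (hγ : Admissible γ) :
    IntegrableOn (fun s => (velocity γ s : Fin d → ℝ)) (Icc 0 1) :=
  ((PiLp.continuous_ofLp 2 _).comp_continuousOn hγ.continuousOn_velocity).integrableOn_Icc

variable [NeZero d]

/-- The Lagrangian is homogeneous of degree one in the velocity, so rescaling time to `[0, 1]`
preserves the energy. Strict positivity makes the rescaled curve admissible. -/
theorem IsWeight.lintegral_endCurve_le_of_continuous (hf : IsWeight Ω f M)
    (hs : ∀ x, f x ≠ 0 → x ∈ unitCube d) {v : ℝ → Fin d → ℝ} (hv : Continuous v)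
    (hpos : ∀ t i, 0 < v t i) {T : ℝ} (hT : 0 < T) (x : E d) :
    ∫⁻ t in Icc 0 T, ENNReal.ofReal (lagrangian f (endCurve x T v t) (v t)) ≤
      ENNReal.ofReal (valueFn f x) := by
  set γ : ℝ → E d := fun s => endCurve x T v (T * s) with hγdef
  have hder : ∀ s, HasDerivAt γ (T • WithLp.toLp 2 (v (T * s))) s := fun s =>
    (hasDerivAt_endCurve hv x T (T * s)).scomp s (by simpa using (hasDerivAt_id s).const_mul T)
  have hcont : Continuous fun s => T • (WithLp.toLp 2 (v (T * s)) : E d) :=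
    ((PiLp.continuous_toLp 2 _).comp (hv.comp (continuous_const_mul T))).const_smul T
  have hC1 : ContDiff ℝ 1 γ := by
    rw [contDiff_one_iff_deriv]
    refine ⟨fun s => (hder s).differentiableAt, ?_⟩
    rw [show deriv γ = _ from funext fun s => (hder s).deriv]
    exact hcont
  have hvel : ∀ s ∈ Icc (0 : ℝ) 1, velocity γ s = T • WithLp.toLp 2 (v (T * s)) := fun s hs =>
    (hder s).hasDerivWithinAt.derivWithin (uniqueDiffOn_Icc zero_lt_one s hs)
  have hadm : Admissible γ := by
    refine ⟨hC1.contDiffOn, fun s hs => ?_⟩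
    rw [hvel s hs]
    refine ⟨fun i => (mul_pos hT (hpos _ i)).le, fun h => ?_⟩
    have h1 := congrArg (fun z : E d => z 0) h
    simp only [PiLp.smul_apply, smul_eq_mul, PiLp.zero_apply] at h1
    exact (mul_pos hT (hpos _ 0)).ne' h1
  have hend : CompLE (γ 1) x := fun i => by simp [hγdef, endCurve_apply]
  refine le_trans (le_of_eq ?_) (ENNReal.ofReal_le_ofReal (hf.energy_le_valueFn hs hadm hend))
  have himg : Icc 0 T = (fun s => T * s) '' Icc (0 : ℝ) 1 := by
    rw [image_mul_left_Icc hT.le zero_le_one, mul_zero, mul_one]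
  rw [hf.ofReal_energy hadm, himg, lintegral_image_eq_lintegral_abs_deriv_mul measurableSet_Icc
    (f' := fun _ => T) (fun s _ => by simpa using ((hasDerivAt_id s).const_mul T).hasDerivWithinAt)
    ((mul_right_injective₀ hT.ne').injOn)]
  refine setLIntegral_congr_fun measurableSet_Icc fun s hs => ?_
  simp only
  rw [hvel s hs, abs_of_pos hT, ← ENNReal.ofReal_mul hT.le,
    ← lagrangian_smul f _ (fun i => (hpos _ i).le) hT.le]
  rfl

/-- Integrable curves do not improve on continuously differentiable ones. -/
theorem IsWeight.lintegral_endCurve_le (hf : IsWeight Ω f M)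
    (hs : ∀ x, f x ≠ 0 → x ∈ unitCube d) {T : ℝ} (hT : 0 < T) {v : ℝ → Fin d → ℝ}
    (hv : IntegrableOn v (Ioc 0 T)) (hnn : ∀ t ∈ Ioc 0 T, ∀ i, 0 ≤ v t i) (x : E d) :
    ∫⁻ t in Ioc 0 T, ENNReal.ofReal (lagrangian f (endCurve x T v t) (v t)) ≤
      ENNReal.ofReal (valueFn f x) := by
  set w : ℝ → Fin d → ℝ := (Ioc 0 T).indicator v with hw
  have hwint : Integrable w := hv.integrable_indicator measurableSet_Ioc
  have hwnn : ∀ t i, 0 ≤ w t i := by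
    intro t i
    by_cases ht : t ∈ Ioc 0 T
    · rw [hw, indicator_of_mem ht]; exact hnn t ht i
    · rw [hw, indicator_of_notMem ht]; exact le_rfl
  have hwend : ∀ t ∈ Ioc 0 T, endCurve x T v t = endCurve x T w t := by
    intro t ht
    ext i
    rw [endCurve_apply, endCurve_apply, intervalIntegral.integral_of_le ht.2,
      intervalIntegral.integral_of_le ht.2]
    congr 1
    refine setIntegral_congr_fun measurableSet_Ioc fun s hs => ?_
    simp only [hw]
    rw [indicator_of_mem (show s ∈ Ioc 0 T from ⟨ht.1.trans hs.1, hs.2⟩)]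
  have happ : ∀ n : ℕ, ∃ g : ℝ → Fin d → ℝ, HasCompactSupport g ∧
      ∫⁻ t, ‖w t - g t‖ₑ ≤ ((n : ENNReal))⁻¹ ∧ Continuous g ∧ Integrable g := fun n =>
    hwint.exists_hasCompactSupport_lintegral_sub_le (by simp)
  choose g _ hg hgc hgi using happ
  have hglim : Tendsto (fun n => ∫⁻ t, ‖g n t - w t‖ₑ) atTop (𝓝 0) := by
    refine tendsto_of_tendsto_of_tendsto_of_le_of_le tendsto_const_nhds
      ENNReal.tendsto_inv_nat_nhds_zero (fun _ => zero_le) fun n => ?_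
    refine le_trans (le_of_eq ?_) (hg n)
    exact lintegral_congr fun t => by rw [← enorm_neg, neg_sub]
  obtain ⟨ns, hns, hae⟩ : ∃ ns : ℕ → ℕ, StrictMono ns ∧
      ∀ᵐ t, Tendsto (fun k => g (ns k) t) atTop (𝓝 (w t)) := by
    refine TendstoInMeasure.exists_seq_tendsto_ae (tendstoInMeasure_of_tendsto_eLpNorm
      (p := 1) one_ne_zero (fun n => (hgi n).aestronglyMeasurable) hwint.aestronglyMeasurable ?_)
    simpa only [eLpNorm_one_eq_lintegral_enorm, Pi.sub_apply] using hglim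
  set η : ℕ → ℝ := fun k => 1 / ((k : ℝ) + 1) with hη
  have hηpos : ∀ k, 0 < η k := fun k => by positivity
  have hηlim : Tendsto η atTop (𝓝 0) := tendsto_one_div_add_atTop_nhds_zero_nat
  -- The positive part restores the sign that approximation may destroy, and `η k` makes the
  -- velocity strictly positive; both corrections vanish in the limit.
  set V : ℕ → ℝ → Fin d → ℝ := fun k t i => max (g (ns k) t i) 0 + η k with hV
  have hVc : ∀ k, Continuous (V k) := by
    intro k
    refine continuous_pi fun i => ?_
    exact (((continuous_apply i).comp (hgc _)).max continuous_const).add continuous_const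
  have hVpos : ∀ k t i, 0 < V k t i := fun k t i =>
    add_pos_of_nonneg_of_pos (le_max_right _ _) (hηpos k)
  have hint : ∀ t ∈ Ioc 0 T, ∀ i, Tendsto (fun k => ∫ s in t..T, V k s i) atTop
      (𝓝 (∫ s in t..T, w s i)) := by
    intro t ht i
    have hwi : Integrable fun s => w s i := hwint.eval i
    have hmi : ∀ k, Integrable fun s => max (g (ns k) s i) 0 := fun k =>
      ((hgi (ns k)).eval i).pos_part
    have h1 : Tendsto (fun k => ∫⁻ s, ‖max (g (ns k) s i) 0 - w s i‖ₑ) atTop (𝓝 0) := by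
      refine tendsto_of_tendsto_of_tendsto_of_le_of_le tendsto_const_nhds
        (hglim.comp hns.tendsto_atTop) (fun _ => zero_le) fun k => ?_
      refine lintegral_mono fun s => ?_
      simp only
      rw [enorm_le_iff_norm_le]
      calc ‖max (g (ns k) s i) 0 - w s i‖ = |max (g (ns k) s i) 0 - max (w s i) 0| := by
            rw [max_eq_left (hwnn s i), Real.norm_eq_abs]
        _ ≤ |g (ns k) s i - w s i| := abs_max_sub_max_le_abs _ _ _
        _ ≤ ‖g (ns k) s - w s‖ := norm_le_pi_norm (g (ns k) s - w s) i
    have h2 := tendsto_setIntegral_of_L1 (fun s => w s i) hwi.aestronglyMeasurable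
      (Eventually.of_forall hmi) h1 (Ioc t T)
    have h3 : Tendsto (fun k => (T - t) * η k) atTop (𝓝 0) := by
      simpa using hηlim.const_mul (T - t)
    have h4 := h2.add h3
    rw [add_zero, ← intervalIntegral.integral_of_le ht.2] at h4
    refine h4.congr fun k => ?_
    rw [← intervalIntegral.integral_of_le ht.2]
    simp only [hV]
    rw [intervalIntegral.integral_add (hmi k).intervalIntegrable
      intervalIntegrable_const, intervalIntegral.integral_const, smul_eq_mul]
  have hend : ∀ t ∈ Ioc 0 T, Tendsto (fun k => endCurve x T (V k) t) atTop
      (𝓝 (endCurve x T w t)) := by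
    intro t ht
    refine ((PiLp.continuous_toLp 2 fun _ : Fin d => ℝ).tendsto _).comp ?_
    exact tendsto_pi_nhds.2 fun i => (hint t ht i).const_sub (x i)
  have hptw : ∀ᵐ t ∂(volume.restrict (Ioc 0 T)),
      ENNReal.ofReal (lagrangian f (endCurve x T v t) (v t)) ≤
        liminf (fun k => ENNReal.ofReal (lagrangian f (endCurve x T (V k) t) (V k t))) atTop := by
    filter_upwards [ae_restrict_mem measurableSet_Ioc, ae_restrict_of_ae hae] with t ht hgt
    have hvw : v t = w t := by rw [hw, indicator_of_mem ht]
    rw [hwend t ht, hvw]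
    -- Lower semicontinuity of the integrand: where `f` vanishes there is nothing to prove, and
    -- where `f > 0` the limit point lies in `Ω`, so `f` is continuous there.
    rcases (hf.nonneg (endCurve x T w t)).eq_or_lt with h0 | h0
    · rw [lagrangian_eq_zero h0.symm, ENNReal.ofReal_zero]
      exact zero_le
    · have hVt : ∀ i, Tendsto (fun k => V k t i) atTop (𝓝 (w t i)) := by
        intro i
        have h1 := ((tendsto_pi_nhds.1 hgt i).max (tendsto_const_nhds (x := (0 : ℝ)))).add hηlim
        rw [max_eq_left (hwnn t i), add_zero] at h1
        exact h1
      have hft : Tendsto (fun k => f (endCurve x T (V k) t)) atTop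
          (𝓝 (f (endCurve x T w t))) :=
        (hf.continuousAt (hf.mem_of_pos h0)).tendsto.comp (hend t ht)
      have hlag : Tendsto (fun k => lagrangian f (endCurve x T (V k) t) (V k t)) atTop
          (𝓝 (lagrangian f (endCurve x T w t) (w t))) :=
        ((continuous_rpow_one_div.tendsto _).comp hft).mul
          ((continuous_rpow_one_div.tendsto _).comp (tendsto_finsetProd _ fun i _ => hVt i))
      exact ((ENNReal.continuous_ofReal.tendsto _).comp hlag).liminf_eq.ge
  calc ∫⁻ t in Ioc 0 T, ENNReal.ofReal (lagrangian f (endCurve x T v t) (v t))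
      ≤ ∫⁻ t in Ioc 0 T, liminf (fun k =>
          ENNReal.ofReal (lagrangian f (endCurve x T (V k) t) (V k t))) atTop :=
        lintegral_mono_ae hptw
    _ ≤ liminf (fun k => ∫⁻ t in Ioc 0 T,
          ENNReal.ofReal (lagrangian f (endCurve x T (V k) t) (V k t))) atTop := by
        refine lintegral_liminf_le fun k => ENNReal.measurable_ofReal.comp (Measurable.mul ?_ ?_)
        · exact (hf.measurable.comp (continuous_endCurve (hVc k) x T).measurable).pow_const _
        · refine Measurable.pow_const (Finset.measurable_fun_prod _ fun i _ => ?_) _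
          exact ((continuous_apply i).comp (hVc k)).measurable
    _ ≤ ENNReal.ofReal (valueFn f x) := by
        refine liminf_le_of_le (by isBoundedDefault) fun b hb => ?_
        obtain ⟨k, hk⟩ := hb.exists
        refine hk.trans ((lintegral_mono_set Ioc_subset_Icc_self).trans ?_)
        exact hf.lintegral_endCurve_le_of_continuous hs (hVc k) (hVpos k) hT x

/-! ### Truncation, boundary values, continuity, and the lower half of dynamic programming. -/

/-- The energy of an initial piece of a curve is bounded by the value function at its endpoint. -/
theorem IsWeight.lintegral_initial_le (hf : IsWeight Ω f M)
    (hs : ∀ x, f x ≠ 0 → x ∈ unitCube d) (hγ : Admissible γ) {t₀ : ℝ} (ht₀ : t₀ ∈ Icc (0 : ℝ) 1) :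
    ∫⁻ t in Icc 0 t₀, ENNReal.ofReal (lagrangian f (γ t) (velocity γ t)) ≤
      ENNReal.ofReal (valueFn f (γ t₀)) := by
  rcases ht₀.1.eq_or_lt with h | h
  · simp [← h]
  · have h1 := hf.lintegral_endCurve_le hs h (v := fun s => velocity γ s)
      (hγ.integrableOn_velocity.mono_set
        (Ioc_subset_Icc_self.trans (Icc_subset_Icc le_rfl ht₀.2)))
      (fun t ht i => hγ.velocity_nonneg ⟨ht.1.le, ht.2.trans ht₀.2⟩ i) (γ t₀)
    rw [setLIntegral_congr Ioc_ae_eq_Icc.symm]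
    refine le_trans (le_of_eq ?_) h1
    refine setLIntegral_congr_fun measurableSet_Ioc fun t ht => ?_
    simp only
    rw [hγ.endCurve_velocity ht.1.le ht.2 ht₀.2]

/-- The energy of the piece of a curve below `x` is bounded by the value function at `x`. -/
theorem IsWeight.lintegral_below_le (hf : IsWeight Ω f M)
    (hs : ∀ x, f x ≠ 0 → x ∈ unitCube d) (hγ : Admissible γ) (x : E d) :
    ∫⁻ t in {t ∈ Icc (0 : ℝ) 1 | CompLE (γ t) x},
      ENNReal.ofReal (lagrangian f (γ t) (velocity γ t)) ≤ ENNReal.ofReal (valueFn f x) := by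
  set S := {t ∈ Icc (0 : ℝ) 1 | CompLE (γ t) x} with hS
  have hSeq : S = {t ∈ Icc (0 : ℝ) 1 | CompLE (γ 0) (γ t) ∧ CompLE (γ t) x} := by
    ext t
    exact ⟨fun ht => ⟨ht.1, hγ.monotone le_rfl ht.1.1 ht.1.2, ht.2⟩, fun ht => ⟨ht.1, ht.2.2⟩⟩
  have hc : IsCompact S := hSeq ▸ hγ.isCompact_preimage_box _ _
  rcases S.eq_empty_or_nonempty with h | hne
  · simp [h]
  · have hb := hc.sSup_mem hne
    refine (lintegral_mono_set fun t ht => ?_).trans ((hf.lintegral_initial_le hs hγ hb.1).trans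
      (ENNReal.ofReal_le_ofReal (hf.valueFn_mono hs hb.2)))
    exact ⟨ht.1.1, le_csSup hc.bddAbove ht⟩

/-- Only times with `f ≠ 0` contribute, so the endpoint constraint may be relaxed to those times;
this is what makes `valueFn` insensitive to truncation. -/
theorem IsWeight.energy_le_valueFn_of_support (hf : IsWeight Ω f M)
    (hs : ∀ x, f x ≠ 0 → x ∈ unitCube d) (hγ : Admissible γ) {x : E d}
    (hx : ∀ t ∈ Icc (0 : ℝ) 1, f (γ t) ≠ 0 → CompLE (γ t) x) : energy f γ ≤ valueFn f x := by
  rw [← ENNReal.ofReal_le_ofReal_iff (valueFn_nonneg hf.nonneg x), hf.ofReal_energy hγ]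
  refine (lintegral_le_of_support measurableSet_Icc fun t ht hne => ?_).trans
    (hf.lintegral_below_le hs hγ x)
  exact ⟨ht, hx t ht fun h0 => hne (by simp [lagrangian_eq_zero h0])⟩

theorem IsWeight.valueFn_truncOne (hf : IsWeight Ω f M) (hs : ∀ x, f x ≠ 0 → x ∈ unitCube d)
    (x : E d) : valueFn f x = valueFn f (truncOne x) := by
  apply le_antisymm
  · refine valueFn_le (valueFn_nonneg hf.nonneg _) fun γ hγ hx => ?_
    refine hf.energy_le_valueFn_of_support hs hγ fun t ht hne i => ?_
    exact le_min ((hγ.monotone ht.1 ht.2 le_rfl i).trans (hx i)) ((hs _ hne i).2)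
  · exact hf.valueFn_mono hs fun i => min_le_left _ _

theorem IsWeight.valueFn_eq_zero (hf : IsWeight Ω f M) (hΩ : Ω ⊆ orthant d) {x : E d} {i : Fin d}
    (hx : x i ≤ 0) : valueFn f x = 0 := by
  refine le_antisymm (valueFn_le le_rfl fun γ hγ hγx => ?_) (valueFn_nonneg hf.nonneg x)
  rw [← ENNReal.ofReal_le_ofReal_iff le_rfl, hf.ofReal_energy hγ]
  refine (lintegral_le_of_support (t := ∅) measurableSet_Icc fun t ht hne => ?_).trans (by simp)
  have h1 : f (γ t) ≠ 0 := fun h0 => hne (by simp [lagrangian_eq_zero h0])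
  have h2 : γ t ∈ Ω := by
    by_contra h
    exact h1 (hf.eq_zero _ h)
  have h3 := hΩ h2 i
  have h4 := (hγ.monotone ht.1 ht.2 le_rfl i).trans (hγx i)
  linarith

/-- Modulus of continuity of the value function. -/
theorem IsWeight.valueFn_le_add (hf : IsWeight Ω f M) (hs : ∀ x, f x ≠ 0 → x ∈ unitCube d)
    (x y : E d) : valueFn f y ≤
      valueFn f x + ∑ i, M ^ (1 / (d : ℝ)) * (max (y i - x i) 0) ^ (1 / (d : ℝ)) := by
  have hM : 0 ≤ M := (hf.nonneg 0).trans (hf.le 0)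
  have hterm : ∀ i, 0 ≤ M ^ (1 / (d : ℝ)) * (max (y i - x i) 0) ^ (1 / (d : ℝ)) := fun i => by
    positivity
  have hnn := valueFn_nonneg hf.nonneg x
  have hsum := Finset.sum_nonneg fun i (_ : i ∈ Finset.univ) => hterm i
  refine valueFn_le (add_nonneg hnn hsum) fun γ hγ hγy => ?_
  rw [← ENNReal.ofReal_le_ofReal_iff (add_nonneg hnn hsum), hf.ofReal_energy hγ,
    ENNReal.ofReal_add hnn hsum, ENNReal.ofReal_sum_of_nonneg fun i _ => hterm i]
  -- Inside the unit cube, a point below `y` but not below `x` lies in one of `d` slabs; the `i`-th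
  -- has unit sides except for thickness `max (y i - x i) 0` in direction `i`.
  let lo : Fin d → E d := fun i => WithLp.toLp 2 (Function.update 0 i (x i))
  let hi : Fin d → E d := fun i => WithLp.toLp 2 (Function.update 1 i (max (y i) (x i)))
  have hloi : ∀ i, lo i i = x i := fun i => by simp [lo]
  have hhii : ∀ i, hi i i = max (y i) (x i) := fun i => by simp [hi]
  have hloj : ∀ i j, j ≠ i → lo i j = 0 := fun i j h => by simp [lo, h]
  have hhij : ∀ i j, j ≠ i → hi i j = 1 := fun i j h => by simp [hi, h]
  let A : Fin d → Set ℝ := fun i =>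
    {t ∈ Icc (0 : ℝ) 1 | CompLE (lo i) (γ t) ∧ CompLE (γ t) (hi i)}
  have hcover : ∀ t ∈ Icc (0 : ℝ) 1,
      ENNReal.ofReal (lagrangian f (γ t) (velocity γ t)) ≠ 0 →
        t ∈ {t ∈ Icc (0 : ℝ) 1 | CompLE (γ t) x} ∪ ⋃ i, A i := by
    intro t ht hne
    have hcube := hs (γ t) fun h0 => hne (by simp [lagrangian_eq_zero h0])
    by_cases h : CompLE (γ t) x
    · exact Or.inl ⟨ht, h⟩
    · simp only [CompLE, not_forall, not_le] at h
      obtain ⟨i, hi'⟩ := h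
      refine Or.inr (mem_iUnion.2 ⟨i, ht, fun j => ?_, fun j => ?_⟩)
      · by_cases hj : j = i
        · subst hj; rw [hloi]; exact hi'.le
        · rw [hloj i j hj]; exact (hcube j).1
      · by_cases hj : j = i
        · subst hj; rw [hhii]
          exact le_max_of_le_left ((hγ.monotone ht.1 ht.2 le_rfl j).trans (hγy j))
        · rw [hhij i j hj]; exact (hcube j).2
  refine (lintegral_le_of_support measurableSet_Icc hcover).trans
    ((lintegral_union_le _ _ _).trans (add_le_add (hf.lintegral_below_le hs hγ x) ?_))
  refine (lintegral_iUnion_le _ _).trans ?_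
  rw [tsum_fintype]
  refine Finset.sum_le_sum fun i _ => ?_
  have h1 := hγ.lintegral_lagrangian_box_le hf.nonneg (lo := lo i) (hi := hi i) (fun j => ?_)
    (c := M) fun t _ _ _ => hf.le _
  · refine h1.trans (le_of_eq ?_)
    congr 3
    rw [Finset.prod_eq_single i, hloi, hhii, ← max_sub_sub_right, sub_self]
    · intro j _ hj
      rw [hloj i j hj, hhij i j hj, sub_zero]
    · simp
  · by_cases hj : j = i
    · subst hj; rw [hloi, hhii]; exact le_max_right _ _
    · rw [hloj i j hj, hhij i j hj]; exact zero_le_one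

theorem IsWeight.continuous_valueFn (hf : IsWeight Ω f M)
    (hs : ∀ x, f x ≠ 0 → x ∈ unitCube d) : Continuous (valueFn f) := by
  refine continuous_iff_continuousAt.2 fun x => ?_
  have hd : (1 / (d : ℝ)) ≠ 0 := one_div_ne_zero (NeZero.ne _)
  have hcont : Continuous fun y : E d =>
      ∑ i, M ^ (1 / (d : ℝ)) * (max (y i - x i) 0) ^ (1 / (d : ℝ)) :=
    continuous_finsetSum _ fun i _ => continuous_const.mul
      (continuous_rpow_one_div.comp (by fun_prop))
  have hcont' : Continuous fun y : E d =>
      ∑ i, M ^ (1 / (d : ℝ)) * (max (x i - y i) 0) ^ (1 / (d : ℝ)) :=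
    continuous_finsetSum _ fun i _ => continuous_const.mul
      (continuous_rpow_one_div.comp (by fun_prop))
  have h1 := hcont.tendsto x
  have h2 := hcont'.tendsto x
  simp only [sub_self, max_self, Real.zero_rpow hd, mul_zero, Finset.sum_const_zero] at h1 h2
  refine tendsto_of_tendsto_of_tendsto_of_le_of_le (g := fun y => valueFn f x -
    ∑ i, M ^ (1 / (d : ℝ)) * (max (x i - y i) 0) ^ (1 / (d : ℝ))) (h := fun y => valueFn f x +
    ∑ i, M ^ (1 / (d : ℝ)) * (max (y i - x i) 0) ^ (1 / (d : ℝ))) ?_ ?_ ?_ ?_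
  · simpa using h2.const_sub (valueFn f x)
  · simpa using h1.const_add (valueFn f x)
  · intro y
    have := hf.valueFn_le_add hs y x
    simp only
    linarith
  · exact fun y => hf.valueFn_le_add hs x y

theorem exists_admissible (z : E d) : ∃ γ : ℝ → E d, Admissible γ ∧ γ 1 = z := by
  set e : E d := WithLp.toLp 2 fun _ => 1 with he
  have hder : ∀ t, HasDerivAt (fun t : ℝ => z + (t - 1) • e) e t := fun t => by
    simpa using (((hasDerivAt_id t).sub_const 1).smul_const e).const_add z
  refine ⟨fun t => z + (t - 1) • e, ⟨ContDiff.contDiffOn (by fun_prop), fun t ht => ?_⟩, by simp⟩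
  have hvel : velocity (fun t : ℝ => z + (t - 1) • e) t = e :=
    (hder t).hasDerivWithinAt.derivWithin (uniqueDiffOn_Icc zero_lt_one t ht)
  rw [hvel]
  refine ⟨fun i => zero_le_one, fun h => ?_⟩
  exact one_ne_zero (congrArg (fun y : E d => y 0) h)

/-- Dynamic programming: extending a curve by a straight segment. -/
theorem IsWeight.valueFn_add_segment_le (hf : IsWeight Ω f M)
    (hs : ∀ x, f x ≠ 0 → x ∈ unitCube d) {z q : E d} (hq : ∀ i, 0 ≤ q i) {c : ℝ} (hc : 0 ≤ c)
    (hseg : ∀ s ∈ Icc (0 : ℝ) 1, c ≤ f (z + s • q)) :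
    valueFn f z + c ^ (1 / (d : ℝ)) * (∏ i, q i) ^ (1 / (d : ℝ)) ≤ valueFn f (z + q) := by
  have hb : 0 ≤ c ^ (1 / (d : ℝ)) * (∏ i, q i) ^ (1 / (d : ℝ)) :=
    mul_nonneg (Real.rpow_nonneg hc _)
      (Real.rpow_nonneg (Finset.prod_nonneg fun i _ => hq i) _)
  have hU := valueFn_nonneg hf.nonneg (z + q)
  suffices H : ∀ γ : ℝ → E d, Admissible γ → CompLE (γ 1) z →
      energy f γ + c ^ (1 / (d : ℝ)) * (∏ i, q i) ^ (1 / (d : ℝ)) ≤ valueFn f (z + q) by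
    -- `valueFn_le` asks for a nonnegative bound; testing `H` on any admissible curve ending at `z`
    -- supplies it.
    have hcase : 0 ≤ valueFn f (z + q) - c ^ (1 / (d : ℝ)) * (∏ i, q i) ^ (1 / (d : ℝ)) := by
      obtain ⟨γ, hγ, hz⟩ := exists_admissible z
      linarith [H γ hγ (hz ▸ fun _ => le_rfl), hγ.energy_nonneg hf.nonneg]
    have := valueFn_le hcase fun γ hγ hz => le_sub_iff_add_le.2 (H γ hγ hz)
    linarith
  intro γ hγ hz
  set x := z + q with hx
  set w : E d := z - γ 1 with hw
  -- Follow `γ`, then the segment from `γ 1` to `z`, whose energy is discarded, then the segment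
  -- from `z` to `z + q`, each in unit time.
  set v : ℝ → Fin d → ℝ := fun s => if s ≤ 1 then velocity γ s else if s ≤ 2 then w else q
    with hv
  have hv1 : EqOn v (fun s => velocity γ s) (Ioc 0 1) := fun s hs => by simp [hv, hs.2]
  have hv2 : EqOn v (fun _ => w) (Ioc 1 2) := fun s hs => by simp [hv, hs.1.not_ge, hs.2]
  have hv3 : EqOn v (fun _ => q) (Ioc 2 3) := fun s hs => by
    simp [hv, hs.1.not_ge, (show ¬ s ≤ 1 by linarith [hs.1])]
  have hi1 : IntegrableOn v (Ioc 0 1) :=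
    (hγ.integrableOn_velocity.mono_set Ioc_subset_Icc_self).congr_fun hv1.symm measurableSet_Ioc
  have hi2 : IntegrableOn v (Ioc 1 2) :=
    (integrableOn_const (by simp)).congr_fun hv2.symm measurableSet_Ioc
  have hi3 : IntegrableOn v (Ioc 2 3) :=
    (integrableOn_const (by simp)).congr_fun hv3.symm measurableSet_Ioc
  have hunion : Ioc (0 : ℝ) 3 = Ioc 0 1 ∪ Ioc 1 2 ∪ Ioc 2 3 := by
    rw [Ioc_union_Ioc_eq_Ioc zero_le_one one_le_two, Ioc_union_Ioc_eq_Ioc (by norm_num)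
      (by norm_num)]
  have hint : IntegrableOn v (Ioc 0 3) := by
    rw [hunion]
    exact (hi1.union hi2).union hi3
  have hnn : ∀ t ∈ Ioc (0 : ℝ) 3, ∀ i, 0 ≤ v t i := by
    intro t ht i
    simp only [hv]
    split_ifs with h1 h2
    · exact hγ.velocity_nonneg ⟨ht.1.le, h1⟩ i
    · exact sub_nonneg.2 (hz i)
    · exact hq i
  have hqi : ∀ t ∈ Icc (2 : ℝ) 3, ∀ i, ∫ s in t..3, v s i = (3 - t) * q i := by
    intro t ht i
    rw [intervalIntegral.integral_of_le ht.2, setIntegral_congr_fun (g := fun _ => q i)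
      measurableSet_Ioc fun s hs => congrFun (hv3 ⟨ht.1.trans_lt hs.1, hs.2⟩) i,
      ← intervalIntegral.integral_of_le ht.2, intervalIntegral.integral_const, smul_eq_mul]
  have hwi : ∀ i, ∫ s in (1 : ℝ)..2, v s i = w i := by
    intro i
    rw [intervalIntegral.integral_of_le one_le_two, setIntegral_congr_fun (g := fun _ => w i)
      measurableSet_Ioc fun s hs => congrFun (hv2 hs) i,
      ← intervalIntegral.integral_of_le one_le_two, intervalIntegral.integral_const, smul_eq_mul]
    norm_num
  have hvi : ∀ t ∈ Ioc (0 : ℝ) 1, ∀ i, ∫ s in t..1, v s i = γ 1 i - γ t i := by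
    intro t ht i
    rw [intervalIntegral.integral_of_le ht.2, setIntegral_congr_fun
      (g := fun s => velocity γ s i)
      measurableSet_Ioc fun s hs => congrFun (hv1 ⟨ht.1.trans hs.1, hs.2⟩) i,
      ← intervalIntegral.integral_of_le ht.2, hγ.integral_velocity ht.1.le ht.2 le_rfl]
  have hii : ∀ a b : ℝ, 0 ≤ a → a ≤ b → b ≤ 3 → ∀ i,
      IntervalIntegrable (fun s => v s i) volume a b := by
    intro a b ha hab hb i
    rw [intervalIntegrable_iff_integrableOn_Ioc_of_le hab]
    have h1 : IntegrableOn v (Ioc a b) := hint.mono_set (Ioc_subset_Ioc ha hb)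
    exact Integrable.eval h1 i
  have hpos1 : ∀ t ∈ Ioc (0 : ℝ) 1, endCurve x 3 v t = γ t := by
    intro t ht
    ext i
    rw [endCurve_apply, ← intervalIntegral.integral_add_adjacent_intervals (b := 2)
      (hii t 2 ht.1.le (by linarith [ht.2]) (by norm_num) i)
      (hii 2 3 (by norm_num) (by norm_num) le_rfl i),
      ← intervalIntegral.integral_add_adjacent_intervals (b := 1)
      (hii t 1 ht.1.le ht.2 (by norm_num) i)
      (hii 1 2 (by norm_num) (by norm_num) (by norm_num) i), hvi t ht i, hwi i,
      hqi 2 ⟨le_rfl, by norm_num⟩ i]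
    simp only [hx, hw, PiLp.add_apply, PiLp.sub_apply]
    ring
  have hpos3 : ∀ t ∈ Ioc (2 : ℝ) 3, endCurve x 3 v t = z + (t - 2) • q := by
    intro t ht
    ext i
    rw [endCurve_apply, hqi t ⟨ht.1.le, ht.2⟩ i]
    simp only [hx, PiLp.add_apply, PiLp.smul_apply, smul_eq_mul]
    ring
  have hmain := hf.lintegral_endCurve_le hs (by norm_num : (0 : ℝ) < 3) hint hnn x
  have hdisj : Disjoint (Ioc (0 : ℝ) 1) (Ioc 2 3) := by
    rw [Set.disjoint_left]
    intro s h1 h2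
    linarith [h1.2, h2.1]
  rw [← ENNReal.ofReal_le_ofReal_iff hU, ENNReal.ofReal_add (hγ.energy_nonneg hf.nonneg) hb,
    hf.ofReal_energy hγ, setLIntegral_congr Ioc_ae_eq_Icc.symm]
  refine le_trans ?_ hmain
  refine le_trans ?_ (lintegral_mono_set (s := Ioc (0 : ℝ) 1 ∪ Ioc 2 3) (union_subset
    (Ioc_subset_Ioc le_rfl (by norm_num)) (Ioc_subset_Ioc (by norm_num) le_rfl)))
  rw [lintegral_union measurableSet_Ioc hdisj]
  refine add_le_add (le_of_eq ?_) ?_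
  · refine setLIntegral_congr_fun measurableSet_Ioc fun t ht => ?_
    simp only
    rw [hpos1 t ht, hv1 ht]
  · have h1 : ENNReal.ofReal (c ^ (1 / (d : ℝ)) * (∏ i, q i) ^ (1 / (d : ℝ))) =
        ∫⁻ _ in Ioc (2 : ℝ) 3,
          ENNReal.ofReal (c ^ (1 / (d : ℝ)) * (∏ i, q i) ^ (1 / (d : ℝ))) := by
      rw [setLIntegral_const, Real.volume_Ioc]
      norm_num
    rw [h1]
    refine setLIntegral_mono' measurableSet_Ioc fun t ht => ENNReal.ofReal_le_ofReal ?_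
    rw [hpos3 t ht, hv3 ht]
    refine mul_le_mul_of_nonneg_right ?_
      (Real.rpow_nonneg (Finset.prod_nonneg fun i _ => hq i) _)
    exact Real.rpow_le_rpow hc
      (hseg _ ⟨by linarith [ht.1], by linarith [ht.2]⟩) (by positivity)

end

/-! ### The value function as a viscosity solution. -/

section

variable {d : ℕ}

/-- AM-GM for the numbers `p i * q i`: the duality between the Hamiltonian and the Lagrangian. -/
theorem mul_rpow_prod_le_sum [NeZero d] {p q : Fin d → ℝ} (hp : ∀ i, 0 ≤ p i)
    (hq : ∀ i, 0 ≤ q i) :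
    d * ((∏ i, p i) ^ (1 / (d : ℝ)) * (∏ i, q i) ^ (1 / (d : ℝ))) ≤ ∑ i, p i * q i := by
  have hd : (d : ℝ) ≠ 0 := NeZero.ne _
  have h := Real.geom_mean_le_arith_mean_weighted Finset.univ (fun _ : Fin d => 1 / (d : ℝ))
    (fun i => p i * q i) (fun _ _ => by positivity) (by simp [hd])
    (fun i _ => mul_nonneg (hp i) (hq i))
  rw [Real.finsetProd_rpow _ _ fun i _ => mul_nonneg (hp i) (hq i), Finset.prod_mul_distrib,
    Real.mul_rpow (Finset.prod_nonneg fun i _ => hp i) (Finset.prod_nonneg fun i _ => hq i),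
    ← Finset.mul_sum] at h
  have h2 := mul_le_mul_of_nonneg_left h (Nat.cast_nonneg (α := ℝ) d)
  rwa [← mul_assoc (d : ℝ) (1 / d), mul_one_div_cancel hd, one_mul] at h2

theorem norm_le_mul_of_forall_abs_le {z : E d} {h : ℝ} (hh : 0 ≤ h) (hz : ∀ i, |z i| ≤ h) :
    ‖z‖ ≤ d * h := by
  have h1 : ‖z‖ ^ 2 ≤ (d * h) ^ 2 := by
    rw [EuclideanSpace.real_norm_sq_eq]
    calc ∑ i, z i ^ 2 ≤ ∑ _i : Fin d, h ^ 2 :=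
          Finset.sum_le_sum fun i _ => sq_le_sq.2 (by rw [abs_of_nonneg hh]; exact hz i)
      _ = d * h ^ 2 := by simp
      _ ≤ d ^ 2 * h ^ 2 := by
          refine mul_le_mul_of_nonneg_right ?_ (sq_nonneg h)
          exact_mod_cast Nat.le_self_pow two_ne_zero d
      _ = (d * h) ^ 2 := by ring
  exact (pow_le_pow_iff_left₀ (norm_nonneg z) (by positivity) two_ne_zero).1 h1

theorem inner_eq_sum_mul (p z : E d) : inner ℝ p z = ∑ i, p i * z i := by
  simp [PiLp.inner_apply, mul_comm]

variable [NeZero d] {Ω : Set (E d)} {f : E d → ℝ} {M : ℝ}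

/-- Dynamic programming: splitting a curve where it enters the cube of side `h` below `x`. -/
theorem IsWeight.exists_entrance (hf : IsWeight Ω f M) (hs : ∀ x, f x ≠ 0 → x ∈ unitCube d)
    {x : E d} {h c : ℝ} (hh : 0 < h)
    (hc : ∀ z : E d, (∀ i, x i - h ≤ z i) → CompLE z x → f z ≤ c)
    {γ : ℝ → E d} (hγ : Admissible γ) (hγx : CompLE (γ 1) x) :
    ∃ y : E d, CompLE y x ∧ (∀ i, x i - h ≤ y i) ∧ (∃ i, y i = x i - h) ∧
      energy f γ ≤
        valueFn f y + c ^ (1 / (d : ℝ)) * (∏ i, (x i - y i)) ^ (1 / (d : ℝ)) := by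
  -- Times at which the curve is not strictly inside the cube. If there are none, `y` is the lower
  -- corner; otherwise `y` is the position at the last such time, projected onto the cube.
  set A := ⋃ i, {t ∈ Icc (0 : ℝ) 1 | γ t i ≤ x i - h} with hA
  have hAc : IsCompact A := isCompact_iUnion fun i => isCompact_Icc.of_isClosed_subset
    ((hγ.continuousOn_apply i).preimage_isClosed_of_isClosed isClosed_Icc isClosed_Iic)
    fun t ht => ht.1
  have hc0 : 0 ≤ c := (hf.nonneg x).trans (hc x (fun i => by linarith) fun _ => le_rfl)
  have hterm : ∀ y : E d, CompLE y x →
      0 ≤ c ^ (1 / (d : ℝ)) * (∏ i, (x i - y i)) ^ (1 / (d : ℝ)) := fun y hy =>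
    mul_nonneg (Real.rpow_nonneg hc0 _)
      (Real.rpow_nonneg (Finset.prod_nonneg fun i _ => sub_nonneg.2 (hy i)) _)
  have hγle : ∀ t ∈ Icc (0 : ℝ) 1, CompLE (γ t) x := fun t ht i =>
    (hγ.monotone ht.1 ht.2 le_rfl i).trans (hγx i)
  have hbox : ∀ y : E d, CompLE y x → (∀ i, x i - h ≤ y i) → _ := fun y hy hy' =>
    hγ.lintegral_lagrangian_box_le hf.nonneg hy (c := c) fun t _ h1 h2 =>
      hc (γ t) (fun i => (hy' i).trans (h1 i)) h2
  rcases A.eq_empty_or_nonempty with hempty | hne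
  · have hγge : ∀ t ∈ Icc (0 : ℝ) 1, ∀ i, x i - h ≤ γ t i := by
      intro t ht i
      by_contra! hlt
      have : t ∈ A := mem_iUnion.2 ⟨i, ht, hlt.le⟩
      rw [hempty] at this
      exact this
    set y : E d := WithLp.toLp 2 fun i => x i - h with hy
    have hyx : CompLE y x := fun i => by simp [hy, hh.le]
    refine ⟨y, hyx, fun i => le_rfl, ⟨0, rfl⟩, ?_⟩
    refine le_add_of_nonneg_of_le (valueFn_nonneg hf.nonneg y) ?_
    rw [← ENNReal.ofReal_le_ofReal_iff (hterm y hyx), hf.ofReal_energy hγ]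
    refine (MeasureTheory.lintegral_mono_set fun t ht => ?_).trans (hbox y hyx fun i => le_rfl)
    exact ⟨ht, hγge t ht, hγle t ht⟩
  · have ht₀ := hAc.sSup_mem hne
    set t₀ := sSup A with ht₀def
    obtain ⟨i₀, ht₀I, hi₀⟩ := mem_iUnion.1 ht₀
    set y : E d := WithLp.toLp 2 fun i => max (γ t₀ i) (x i - h) with hy
    have hyi : ∀ i, y i = max (γ t₀ i) (x i - h) := fun i => rfl
    have hyx : CompLE y x := fun i => max_le (hγle t₀ ht₀I i) (by linarith)
    have hyge : ∀ i, x i - h ≤ y i := fun i => le_max_right _ _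
    refine ⟨y, hyx, hyge, ⟨i₀, by rw [hyi, max_eq_right hi₀]⟩, ?_⟩
    have hU := valueFn_nonneg hf.nonneg y
    rw [← ENNReal.ofReal_le_ofReal_iff (add_nonneg hU (hterm y hyx)), hf.ofReal_energy hγ,
      ENNReal.ofReal_add hU (hterm y hyx)]
    refine le_trans (MeasureTheory.lintegral_mono_set (t :=
      {t ∈ Icc (0 : ℝ) 1 | CompLE (γ t) y} ∪
        {t ∈ Icc (0 : ℝ) 1 | CompLE y (γ t) ∧ CompLE (γ t) x}) fun t ht => ?_)
      ((MeasureTheory.lintegral_union_le _ _ _).trans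
        (add_le_add (hf.lintegral_below_le hs hγ y) (hbox y hyx hyge)))
    rcases le_or_gt t t₀ with hle | hlt
    · exact Or.inl ⟨ht, fun i => (hγ.monotone ht.1 hle ht₀I.2 i).trans (le_max_left _ _)⟩
    · refine Or.inr ⟨ht, fun i => max_le (hγ.monotone ht₀I.1 hlt.le ht.2 i) ?_, hγle t ht⟩
      by_contra! hcon
      have h1 : t ∈ A := mem_iUnion.2 ⟨i, ht, hcon.le⟩
      exact hlt.not_ge (le_csSup hAc.bddAbove h1)

/-- If a supergradient violated the inequality, every curve ending below `x` would fall short of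
`valueFn f x` by a fixed amount, contradicting the supremum. -/
theorem IsWeight.isViscSub_valueFn (hf : IsWeight Ω f M) (hs : ∀ x, f x ≠ 0 → x ∈ unitCube d)
    {O : Set (E d)} (hO : IsOpen O) : IsViscSub O prodH f fun x => d * valueFn f x := by
  have hdpos : (0 : ℝ) < d := Nat.cast_pos.2 (Nat.pos_of_ne_zero (NeZero.ne d))
  refine ⟨((hf.continuous_valueFn hs).const_mul _).continuousOn, fun x hx p hp => ?_⟩
  have hpnn : ∀ i, 0 ≤ p i := nonneg_of_mem_superDiff hO
    (fun a _ b _ hab => mul_le_mul_of_nonneg_left (hf.valueFn_mono hs hab) hdpos.le) hx hp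
  by_contra! hlt
  obtain ⟨c, hc1, hc2⟩ := exists_between hlt
  have hcpos : 0 < c := (hf.uscEnv_nonneg hO hx).trans_lt hc1
  have hHpos : 0 < prodH p := hcpos.trans hc2
  have hppos : ∀ i, 0 < p i := fun i => (hpnn i).lt_of_ne' fun h0 =>
    hHpos.ne' (Finset.prod_eq_zero (Finset.mem_univ i) h0)
  obtain ⟨i₁, hi₁⟩ := Finite.exists_min fun i => p i
  set m := p i₁ with hm
  have hmpos : 0 < m := hppos i₁
  set θ := (c / prodH p) ^ (1 / (d : ℝ)) with hθ
  have hθ1 : θ < 1 := Real.rpow_lt_one (by positivity) ((div_lt_one hHpos).2 hc2) (by positivity)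
  have hcθ : c ^ (1 / (d : ℝ)) = θ * prodH p ^ (1 / (d : ℝ)) := by
    rw [hθ, ← Real.mul_rpow (by positivity) hHpos.le, div_mul_cancel₀ _ hHpos.ne']
  have hθ0 : 0 ≤ θ := by positivity
  -- On the cube of side `h` the expansion error is at most `ε * (d * h)`, half of the deficit `(1 -
  -- θ) * m * h` that AM-GM produces when some coordinate of `y` is `x i - h`.
  set ε := (1 - θ) * m / (2 * d) with hε
  have hεpos : 0 < ε := div_pos (mul_pos (by linarith) hmpos) (by positivity)
  have hnear := hp ε hεpos
  rw [hO.nhdsWithin_eq hx] at hnear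
  obtain ⟨r, hr, hball⟩ := Metric.eventually_nhds_iff.1 (hnear.and (hf.eventually_lt hO hx hc1))
  set h := r / (2 * d) with hh
  have hhpos : 0 < h := by positivity
  have hdh : d * h < r := by
    rw [hh]
    field_simp
    linarith
  have hdist : ∀ z : E d, (∀ i, x i - h ≤ z i) → CompLE z x → ‖z - x‖ ≤ d * h := by
    intro z h1 h2
    refine norm_le_mul_of_forall_abs_le hhpos.le fun i => ?_
    rw [PiLp.sub_apply, abs_le]
    constructor <;> linarith [h1 i, h2 i]
  have hin : ∀ z : E d, (∀ i, x i - h ≤ z i) → CompLE z x → dist z x < r := by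
    intro z h1 h2
    rw [dist_eq_norm]
    exact (hdist z h1 h2).trans_lt hdh
  have hkey : ∀ γ : ℝ → E d, Admissible γ → CompLE (γ 1) x →
      energy f γ ≤ valueFn f x - (1 - θ) * m * h / (2 * d) := by
    intro γ hγ hγx
    obtain ⟨y, hyx, hyge, ⟨i, hyi⟩, hen⟩ := hf.exists_entrance hs hhpos
      (fun z h1 h2 => (hball (hin z h1 h2)).2.le) hγ hγx
    have h1 := (hball (hin y hyge hyx)).1
    have h2 := mul_le_mul_of_nonneg_left (hdist y hyge hyx) hεpos.le
    have h3 := mul_rpow_prod_le_sum hpnn (q := fun i => x i - y i)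
      fun i => sub_nonneg.2 (hyx i)
    have h4 : inner ℝ p (y - x) = -∑ i, p i * (x i - y i) := by
      rw [inner_eq_sum_mul, ← Finset.sum_neg_distrib]
      exact Finset.sum_congr rfl fun i _ => by rw [PiLp.sub_apply]; ring
    have h5 : m * h ≤ ∑ i, p i * (x i - y i) := by
      refine le_trans ?_ (Finset.single_le_sum (f := fun i => p i * (x i - y i))
        (fun j _ => mul_nonneg (hpnn j) (sub_nonneg.2 (hyx j))) (Finset.mem_univ i))
      simp only [hyi, sub_sub_cancel]
      exact mul_le_mul_of_nonneg_right (hi₁ i) hhpos.le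
    have h6 : ε * (d * h) = (1 - θ) * m * h / 2 := by
      rw [hε]
      field_simp
    have h7 : prodH p = ∏ i, p i := rfl
    rw [hcθ, h7] at hen
    rw [h4] at h1
    have h8 := mul_le_mul_of_nonneg_left hen hdpos.le
    have h9 := mul_le_mul_of_nonneg_left h3 hθ0
    have h10 := mul_le_mul_of_nonneg_left h5 (by linarith : 0 ≤ 1 - θ)
    have h11 : d * (valueFn f x - (1 - θ) * m * h / (2 * d)) =
        d * valueFn f x - (1 - θ) * m * h / 2 := by
      field_simp
    refine le_of_mul_le_mul_left ?_ hdpos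
    rw [h11]
    linarith
  obtain ⟨γ, hγ, hγx⟩ := exists_admissible x
  have hC := (hγ.energy_nonneg hf.nonneg).trans (hkey γ hγ (hγx ▸ fun _ => le_rfl))
  have := valueFn_le hC hkey
  have hpos : 0 < (1 - θ) * m * h / (2 * d) :=
    div_pos (mul_pos (mul_pos (by linarith) hmpos) hhpos) (by positivity)
  linarith

/-- Appending short segments in every direction `q ≥ 0` gives a linear lower bound on `⟨p, q⟩`;
optimizing over `q` recovers the product of the `p i`. -/
theorem IsWeight.isViscSuper_valueFn (hf : IsWeight Ω f M) (hs : ∀ x, f x ≠ 0 → x ∈ unitCube d)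
    {O : Set (E d)} (hO : IsOpen O) : IsViscSuper O prodH f fun x => d * valueFn f x := by
  have hdpos : (0 : ℝ) < d := Nat.cast_pos.2 (Nat.pos_of_ne_zero (NeZero.ne d))
  refine ⟨((hf.continuous_valueFn hs).const_mul _).continuousOn, fun x hx p hp => ?_⟩
  have hpnn : ∀ i, 0 ≤ p i := nonneg_of_mem_subDiff hO
    (fun a _ b _ hab => mul_le_mul_of_nonneg_left (hf.valueFn_mono hs hab) hdpos.le) hx hp
  rw [hf.lscEnv_eq hO hx]
  refine le_of_forall_lt_imp_le_of_dense fun c hc => ?_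
  rcases le_or_gt c 0 with hc0 | hcpos
  · exact hc0.trans (Finset.prod_nonneg fun i _ => hpnn i)
  have hxΩ : x ∈ Ω := hf.mem_of_pos (hcpos.trans hc)
  obtain ⟨r, hr, hball⟩ := Metric.eventually_nhds_iff.1
    ((hf.continuousAt hxΩ).eventually_const_lt hc)
  have hdual : ∀ q : E d, (∀ i, 0 ≤ q i) →
      d * (c ^ (1 / (d : ℝ)) * (∏ i, q i) ^ (1 / (d : ℝ))) ≤ ∑ i, p i * q i := by
    intro q hq
    rw [← inner_eq_sum_mul]
    refine le_of_forall_pos_le_add fun ε hε => ?_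
    have hε' : 0 < ε / (‖q‖ + 1) := by positivity
    have hnear := hp _ hε'
    rw [hO.nhdsWithin_eq hx] at hnear
    have hev := (tendsto_sub_smul_nhds x q).eventually
      (hnear.and (Metric.ball_mem_nhds x hr))
    obtain ⟨h, ⟨h1, h2⟩, h3⟩ := (hev.and self_mem_nhdsWithin).exists
    have hpos : 0 < h := h3
    have h4 := hf.valueFn_add_segment_le hs (z := x - h • q) (q := h • q)
      (fun i => mul_nonneg hpos.le (hq i)) hcpos.le fun s hs => by
        refine (hball ?_).le
        rw [dist_eq_norm, sub_sub_cancel_left, norm_neg] at h2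
        rw [dist_eq_norm, show x - h • q + s • h • q - x = (-(1 - s)) • h • q by module,
          norm_smul, norm_neg, Real.norm_eq_abs, abs_of_nonneg (by linarith [hs.2])]
        nlinarith [norm_nonneg (h • q), hs.1]
    simp only [PiLp.smul_apply, smul_eq_mul, sub_add_cancel] at h4
    rw [rpow_prod_mul hq hpos.le] at h4
    rw [sub_sub_cancel_left, inner_neg_right, inner_smul_right, norm_neg, norm_smul,
      Real.norm_eq_abs, abs_of_pos hpos] at h1
    have h5 : ε / (‖q‖ + 1) * ‖q‖ ≤ ε := by
      rw [div_mul_eq_mul_div, div_le_iff₀ (by positivity)]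
      nlinarith
    have h6 := mul_le_mul_of_nonneg_left h4 hdpos.le
    refine le_of_mul_le_mul_left ?_ hpos
    nlinarith [mul_le_mul_of_nonneg_left h5 hpos.le]
  have hδ : ∀ δ : ℝ, 0 < δ → c ≤ ∏ i, (p i + δ) := by
    intro δ hδ
    have hpδ : ∀ i, 0 < p i + δ := fun i => add_pos_of_nonneg_of_pos (hpnn i) hδ
    -- The equality case of AM-GM is `q i = (p i)⁻¹`; the shift by `δ` allows vanishing components.
    have h1 := hdual (WithLp.toLp 2 fun i => (p i + δ)⁻¹) fun i => (inv_pos.2 (hpδ i)).le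
    simp only at h1
    have h2 : ∑ i, p i * (p i + δ)⁻¹ ≤ d * 1 := by
      calc ∑ i, p i * (p i + δ)⁻¹ ≤ ∑ _i : Fin d, (1 : ℝ) := by
            refine Finset.sum_le_sum fun i _ => ?_
            rw [← div_eq_mul_inv, div_le_one (hpδ i)]
            linarith
        _ = d * 1 := by simp
    have h3 := le_of_mul_le_mul_left (h1.trans h2) hdpos
    have hprod : 0 < ∏ i, (p i + δ) := Finset.prod_pos fun i _ => hpδ i
    rw [Finset.prod_inv_distrib, ← Real.mul_rpow hcpos.le (by positivity)] at h3
    have h4 := (Real.rpow_le_one_iff_of_pos (by positivity)).1 h3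
    rcases h4 with h4 | h4
    · have : (1 / (d : ℝ)) > 0 := by positivity
      linarith [h4.2]
    · rw [← div_eq_mul_inv, div_le_one hprod] at h4
      exact h4.1
  have hlim : Tendsto (fun δ : ℝ => ∏ i, (p i + δ)) (𝓝[>] 0) (𝓝 (prodH p)) := by
    have h1 : Continuous fun δ : ℝ => ∏ i, (p i + δ) := by fun_prop
    have h2 := h1.tendsto 0
    simp only [add_zero] at h2
    exact h2.mono_left nhdsWithin_le_nhds
  exact ge_of_tendsto hlim (by filter_upwards [self_mem_nhdsWithin] with δ h using hδ δ h)

theorem IsWeight.isParetoSolution_valueFn (hf : IsWeight Ω f M)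
    (hs : ∀ x, f x ≠ 0 → x ∈ unitCube d) (hΩ : Ω ⊆ orthant d) :
    IsParetoSolution f fun x => d * valueFn f x where
  continuousOn := ((hf.continuous_valueFn hs).const_mul _).continuousOn
  viscosity := ⟨hf.isViscSub_valueFn hs (isOpen_orthant d),
    hf.isViscSuper_valueFn hs (isOpen_orthant d)⟩
  boundary := fun x hx => by
    obtain ⟨i, hi⟩ := exists_nonpos_of_mem_frontier_orthant hx
    simp only [hf.valueFn_eq_zero hΩ hi, mul_zero]
  monotone := fun x _ y _ hxy =>
    mul_le_mul_of_nonneg_left (hf.valueFn_mono hs hxy) (Nat.cast_nonneg d)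
  truncation := fun x _ => by
    simp only [← hf.valueFn_truncOne hs x]

end

end ParetoHJ

end

theorem mainTheorem3 (d : ℕ) (hd : 2 ≤ d)
    (Ω : Set (ParetoHJ.E d)) (f : ParetoHJ.E d → ℝ)
    (hΩ_open : IsOpen Ω) (hΩ_bdd : Bornology.IsBounded Ω)
    (hΩ_orthant : Ω ⊆ ParetoHJ.orthant d)
    (hΩ_cone : ParetoHJ.ConeCondition Ω)
    (hf_nonneg : ∀ x, 0 ≤ f x)
    (hf_modulus : ParetoHJ.HasModulusOn Ω f)
    (hf_supp : tsupport f ⊆ ParetoHJ.unitCube d) :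
    ParetoHJ.IsParetoSolution f (fun x => (d : ℝ) * ParetoHJ.valueFn f x) ∧
      ∀ u : ParetoHJ.E d → ℝ, ParetoHJ.IsParetoSolution f u →
        Set.EqOn u (fun x => (d : ℝ) * ParetoHJ.valueFn f x)
          (closure (ParetoHJ.orthant d)) := by
  have : NeZero d := ⟨by omega⟩
  obtain ⟨M, hf⟩ := ParetoHJ.exists_isWeight hΩ_open hΩ_bdd hf_nonneg hf_modulus
  have hsol := hf.isParetoSolution_valueFn (fun x hx => hf_supp (subset_tsupport f hx)) hΩ_orthant
  exact ⟨hsol, fun u hu x hx => le_antisymm (hu.le hd hf hΩ_cone hf_modulus hsol hx)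
    (hsol.le hd hf hΩ_cone hf_modulus hu hx)⟩
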